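/- Let $n\geq 1$ (for $n=1$ the manifolds below are single points, and the curvatures and the empty sums in the formulas are read as $0$). Let $f:\left]0,1\right[\to\mathbb R$ be admissible, i.e. $f$ has an analytic extension to a neighbourhood of $\left]0,1\right[$ in $\mathbb C$ and $f'(x)\neq 0$ for all $x\in\left]0,1\right[$. Let $\mathcal M_n$ be the set of real (respectively complex) self-adjoint positive definite $n\times n$ matrices with trace $1$, and let $g_f$ be the Riemannian metric on $\mathcal M_n$ that is the pull-back, along $D\mapsto f(D)$, of the Euclidean metric $(X,Y)\mapsto\operatorname{Tr}XY$ of the space of self-adjoint matrices, so that $g_f(D)(X,Y)=\operatorname{Tr}\bigl(df(D)(X)\,df(D)(Y)\bigr)$. For $D\in\mathcal M_n$ with eigenvalues $\lambda_1,\dots,\lambda_n$ (with multiplicity) put $$M_{ii}=f'(\lambda_i),\qquad M_{iii}=\tfrac12 f''(\lambda_i),\qquad c=\sqrt{\sum_{k=1}^n\frac1{f'(\lambda_k)^2}},$$ $$\rho_{ij}=-\frac{1}{f'(\lambda_i)f'(\lambda_j)}\,\frac{f'(\lambda_i)-f'(\lambda_j)}{f(\lambda_i)-f(\lambda_j)}\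 \text{ if }\lambda_i\ne\lambda_j,\qquad \rho_{ij}=-\frac{f''(\lambda_i)}{f'(\lambda_i)^3}\ \text{ if }\lambda_i=\lambda_j,$$ $$A=\sum_{i\ne k}\frac{M_{iii}M_{kkk}}{M_{ii}^3M_{kk}^3}\Bigl(c^2-\frac1{M_{ii}^2}-\frac1{M_{kk}^2}\Bigr),\qquad B=\sum_{k}\frac{M_{kkk}}{M_{kk}^3}\Bigl(c^2-\frac1{M_{kk}^2}\Bigr),\qquad P=\sum_{i<j}\rho_{ij},\qquad Q=\sum_{i<j}\rho_{ij}^2 .$$ (1) The scalar curvature of $(\mathcal M_n,g_f)$ at $D$ is, for real matrices and for complex matrices respectively, $$\operatorname{Scal}(D)_{\mathbb R}=\frac4{c^4}\bigl(A-BP\bigr)+\frac{P^2}{c^2}-\frac{Q}{c^2},\qquad \operatorname{Scal}(D)_{\mathbb C}=\frac4{c^4}\bigl(A-2BP\bigr)+\frac{4P^2}{c^2}-\frac{2Q}{c^2}.$$ (2) The submanifold of diagonal matrices in $\mathcal M_n$, with the restriction of $g_f$, has at a diagonal state $D$ (whose eigenvalues are $\lambda_i=D_{ii}$) the scalar curvature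 $\dfrac{4}{c^4}A$. (3) For every $\alpha\in\mathbb R$, including $\alpha=1$, let $\mathcal P_n=\{\vartheta\in\mathbb R^n:\vartheta_k>0,\ \sum_k\vartheta_k=1\}$ carry the pull-back $g_\alpha$ of the canonical metric of $\mathbb R^n$ along $\vartheta\mapsto\frac{2}{1-\alpha}\bigl(\vartheta_1^{(1-\alpha)/2},\dots,\vartheta_n^{(1-\alpha)/2}\bigr)$ if $\alpha\ne1$ and along $\vartheta\mapsto(\log\vartheta_1,\dots,\log\vartheta_n)$ if $\alpha=1$. The scalar curvature of $(\mathcal P_n,g_\alpha)$ at $\vartheta$ is $$\operatorname{Scal}(\vartheta)=\frac{(1+\alpha)^2}{4c(\vartheta)^2}\sum_{t\ne s}\vartheta_t^\alpha\vartheta_s^\alpha\Bigl(1-\frac{\vartheta_t^{\alpha+1}+\vartheta_s^{\alpha+1}}{c(\vartheta)^2}\Bigr),\qquad c(\vartheta)=\sqrt{\sum_k\vartheta_k^{\alpha+1}} .$$ -/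

import Mathlib

noncomputable section

/-! ### Riemannian metrics on open subsets of an affine space

Let `T` be a finite-dimensional subspace of a real vector space `E`. A metric on a relatively open
subset of an affine subspace `p₀ + T` is a function `g`, where `g p X Y` is the scalar product
at `p` of the tangent vectors `X, Y ∈ T`. A basis `b` of `T` gives affine coordinates
`x ↦ p₀ + ∑ xᵢ bᵢ`, and the partial derivative `∂ᵢ` in these coordinates is the derivative along
the line `t ↦ p + t bᵢ`. The notions below are the classical ones in these coordinates. -/

section Riemannian

variable {E : Type*} [AddCommGroup E] [Module ℝ E]

/-- The derivative at `p` of a map `φ` in the direction `X`. -/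
def dirDeriv {F : Type*} [AddCommGroup F] [Module ℝ F] [TopologicalSpace F]
    (φ : E → F) (p X : E) : F :=
  deriv (fun t : ℝ => φ (p + t • X)) 0

/-- The pull-back along `φ` of the constant metric `B` of a vector space `F`. -/
def pullbackMetric {F : Type*} [AddCommGroup F] [Module ℝ F] [TopologicalSpace F]
    (B : F → F → ℝ) (φ : E → F) (p X Y : E) : ℝ :=
  B (dirDeriv φ p X) (dirDeriv φ p Y)

variable {T : Submodule ℝ E} {d : ℕ} (b : Module.Basis (Fin d) ℝ T) (g : E → E → E → ℝ)

/-- The partial derivative `∂ᵢ u` in the coordinates given by `b`. -/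
def partialDeriv (i : Fin d) (u : E → ℝ) (p : E) : ℝ :=
  dirDeriv u p (b i : E)

/-- The metric tensor `g_ij`. -/
def metricTensor (p : E) : Matrix (Fin d) (Fin d) ℝ :=
  Matrix.of fun i j => g p (b i : E) (b j : E)

/-- The Christoffel symbol `Γ_ij^k` of the Levi-Civita connection, so that
`∇_{∂ᵢ} ∂ⱼ = ∑ₖ Γ_ij^k ∂ₖ`. -/
def christoffel (i j k : Fin d) (p : E) : ℝ :=
  (1 / 2) * ∑ m, (metricTensor b g p)⁻¹ k m *
    (partialDeriv b i (fun q => metricTensor b g q j m) p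
      + partialDeriv b j (fun q => metricTensor b g q i m) p
      - partialDeriv b m (fun q => metricTensor b g q i j) p)

/-- The component `R_ijk^l` of the Riemannian curvature tensor
`R(X, Y) Z = ∇_X ∇_Y Z - ∇_Y ∇_X Z - ∇_[X,Y] Z`, so that `R(∂ᵢ, ∂ⱼ) ∂ₖ = ∑ₗ R_ijk^l ∂ₗ`. -/
def riemannTensor (i j k l : Fin d) (p : E) : ℝ :=
  partialDeriv b i (christoffel b g j k l) p - partialDeriv b j (christoffel b g i k l) p
    + ∑ m, (christoffel b g j k m p * christoffel b g i m l p
        - christoffel b g i k m p * christoffel b g j m l p)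

/-- The Ricci tensor `Ric_jk`, where `Ric(Y, Z)` is the trace of `X ↦ R(X, Y) Z`. -/
def ricciTensor (j k : Fin d) (p : E) : ℝ :=
  ∑ i, riemannTensor b g i j k i p

/-- The scalar curvature `∑ g^{jk} Ric_jk`; equivalently `∑ g(R(A_t, A_s) A_s, A_t)` over an
orthonormal basis `(A_t)` of the tangent space. -/
def scalarCurvature (p : E) : ℝ :=
  ∑ j, ∑ k, (metricTensor b g p)⁻¹ j k * ricciTensor b g j k p

end Riemannian

/-! ### State spaces and their pull-back geometries -/

/-- A function `f : ]0,1[ → ℝ` is admissible if it has an analytic extension to a neighbourhood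
of `]0,1[` in the complex plane and `f'` does not vanish on `]0,1[`.
The values of `f` outside `]0,1[` are arbitrary. -/
def Admissible (f : ℝ → ℝ) : Prop :=
  (∃ (U : Set ℂ) (F : ℂ → ℂ), IsOpen U ∧ (∀ x ∈ Set.Ioo (0 : ℝ) 1, (x : ℂ) ∈ U) ∧
      DifferentiableOn ℂ F U ∧ ∀ x ∈ Set.Ioo (0 : ℝ) 1, F (x : ℂ) = (f x : ℂ)) ∧
    ∀ x ∈ Set.Ioo (0 : ℝ) 1, deriv f x ≠ 0

section Quantum

open scoped ComplexOrder

variable (𝕜 : Type) [RCLike 𝕜] (n : ℕ)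

/-- The space `M_n` of real or complex positive definite matrices with trace one. -/
def stateSpace : Set (Matrix (Fin n) (Fin n) 𝕜) :=
  {D | D.PosDef ∧ D.trace = 1}

variable {𝕜 n} in
theorem stateSpace.isHermitian {D : Matrix (Fin n) (Fin n) 𝕜} (hD : D ∈ stateSpace 𝕜 n) :
    D.IsHermitian :=
  hD.1.isHermitian

/-- The tangent space of `M_n`: the self-adjoint matrices with trace zero. -/
def stateTangent : Submodule ℝ (Matrix (Fin n) (Fin n) 𝕜) where
  carrier := {X | X.IsHermitian ∧ X.trace = 0}
  zero_mem' := ⟨Matrix.isHermitian_zero, Matrix.trace_zero _ _⟩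
  add_mem' := fun {X Y} hX hY => ⟨hX.1.add hY.1, by rw [Matrix.trace_add, hX.2, hY.2, add_zero]⟩
  smul_mem' := fun r X hX => ⟨by
    unfold Matrix.IsHermitian
    rw [Matrix.conjTranspose_smul, hX.1.eq, star_trivial], by
    rw [Matrix.trace_smul, hX.2, smul_zero]⟩

/-- The tangent space of the space of diagonal states: the diagonal self-adjoint matrices with
trace zero. -/
def diagTangent : Submodule ℝ (Matrix (Fin n) (Fin n) 𝕜) where
  carrier := {X | X ∈ stateTangent 𝕜 n ∧ X.IsDiag}
  zero_mem' := ⟨Submodule.zero_mem _, Matrix.isDiag_zero⟩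
  add_mem' := fun hX hY => ⟨Submodule.add_mem _ hX.1 hY.1, hX.2.add hY.2⟩
  smul_mem' := fun r _ hX => ⟨Submodule.smul_mem _ r hX.1, hX.2.smul r⟩

variable {𝕜 n}

/-- The Euclidean metric `Tr XY` of the space of self-adjoint matrices. -/
def traceMetric (X Y : Matrix (Fin n) (Fin n) 𝕜) : ℝ :=
  RCLike.re (X * Y).trace

/-- The metric `g_f`: the pull-back of the Euclidean metric along `D ↦ f(D)`, where `f(D)` is given
by the functional calculus of self-adjoint matrices. -/
def gf (f : ℝ → ℝ) (D X Y : Matrix (Fin n) (Fin n) 𝕜) : ℝ :=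
  pullbackMetric traceMetric (fun A : Matrix (Fin n) (Fin n) 𝕜 => cfc f A) D X Y

end Quantum

section Classical

/-- The space `P_n` of strictly positive probability distributions on `n` points. -/
def probSpace (n : ℕ) : Set (Fin n → ℝ) :=
  {θ | (∀ k, 0 < θ k) ∧ ∑ k, θ k = 1}

/-- The tangent space of `P_n`. -/
def probTangent (n : ℕ) : Submodule ℝ (Fin n → ℝ) where
  carrier := {a | ∑ k, a k = 0}
  zero_mem' := by simp
  add_mem' := fun {a c} (ha : ∑ k, a k = 0) (hc : ∑ k, c k = 0) => by
    simp [Finset.sum_add_distrib, ha, hc]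
  smul_mem' := fun r a (ha : ∑ k, a k = 0) => by
    simp [← Finset.mul_sum, ha]

/-- The function which defines the `α`-geometry. -/
def alphaFun (α x : ℝ) : ℝ :=
  if α = 1 then Real.log x else 2 / (1 - α) * x ^ ((1 - α) / 2)

/-- The metric `g_α` of the `α`-geometry of `P_n`: the pull-back of the canonical metric of `ℝⁿ`
along `θ ↦ (alphaFun α θ₁, …, alphaFun α θₙ)`. -/
def gAlpha {n : ℕ} (α : ℝ) (θ X Y : Fin n → ℝ) : ℝ :=
  pullbackMetric (fun x y : Fin n → ℝ => ∑ i, x i * y i)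
    (fun (η : Fin n → ℝ) (i : Fin n) => alphaFun α (η i)) θ X Y

end Classical

/-! ### The quantities in the curvature formulas -/

section Formulas

/-- `M_ii = f'(λᵢ)`, as a function of `λᵢ`. -/
def M₂ (f : ℝ → ℝ) (x : ℝ) : ℝ := deriv f x

/-- `M_iii = f''(λᵢ) / 2`, as a function of `λᵢ`. -/
def M₃ (f : ℝ → ℝ) (x : ℝ) : ℝ := deriv (deriv f) x / 2

/-- `ρ_ij`, as a function of `λᵢ` and `λⱼ`. -/
def rho (f : ℝ → ℝ) (x y : ℝ) : ℝ :=
  if x = y then -(deriv (deriv f) x / deriv f x ^ 3)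
  else -(1 / (deriv f x * deriv f y) * ((deriv f x - deriv f y) / (f x - f y)))

variable {n : ℕ} (f : ℝ → ℝ) (l : Fin n → ℝ)

/-- `c = √(∑ₖ 1 / f'(λₖ)²)`. -/
def cNorm : ℝ := √(∑ k, 1 / deriv f (l k) ^ 2)

/-- The sum over all `i ≠ k` of
`M_iii M_kkk / (M_ii³ M_kk³) (c² - 1 / M_ii² - 1 / M_kk²)`. -/
def diagDoubleSum : ℝ :=
  ∑ i, ∑ k ∈ Finset.univ.erase i,
    M₃ f (l i) * M₃ f (l k) / (M₂ f (l i) ^ 3 * M₂ f (l k) ^ 3) *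
      (cNorm f l ^ 2 - 1 / M₂ f (l i) ^ 2 - 1 / M₂ f (l k) ^ 2)

/-- The sum over all `k` of `M_kkk / M_kk³ (c² - 1 / M_kk²)`. -/
def diagSum : ℝ :=
  ∑ k, M₃ f (l k) / M₂ f (l k) ^ 3 * (cNorm f l ^ 2 - 1 / M₂ f (l k) ^ 2)

/-- The sum over all `i < j` of `ρ_ij`. -/
def rhoSum : ℝ := ∑ i, ∑ j ∈ Finset.Ioi i, rho f (l i) (l j)

/-- The sum over all `i < j` of `ρ_ij²`. -/
def rhoSqSum : ℝ := ∑ i, ∑ j ∈ Finset.Ioi i, rho f (l i) (l j) ^ 2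

end Formulas

end

/-!
The map `D ↦ f(D)` embeds the state space as a hypersurface of the Euclidean space of self-adjoint
matrices. Since `Tr (df(D)(X) · (1 / f')(D)) = Tr X`, the matrix `(1 / f')(D)` is normal to it and
has length `c`, whatever the multiplicities of the eigenvalues. In an eigenbasis of `D` both
`df(D)` and `d(1 / f')(D)` act on the entries of `X`, as multiplication by the divided differences
of `f` and `1 / f'` at the pairs `(λᵢ, λⱼ)`, and the quotients of these are the `ρᵢⱼ`. So the
normal field varies along the hypersurface by a diagonal matrix with entries `ρᵢⱼ`, each occurring
once for `i = j` and `dim_ℝ 𝕜` times for `i < j`. The Gauss equation expresses the scalar curvature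
through the diagonal matrix compressed to the tangent space as
`c⁻² ∑_{a ≠ b} ρₐ ρ_b (1 - νₐ - ν_b)`, where `νₐ` are the squared coordinates of the unit normal,
`1 / (f'(λᵢ) c)²` on the diagonal and `0` off it.

Diagonal states and the `α`-geometry give the same situation without the off-diagonal coordinates.
The smoothness of `D ↦ f(D)` which all this needs comes from the Riesz integral
`f(D) = (2πi)⁻¹ ∮ f(z) (z - D)⁻¹ dz`.
-/

open Filter Topology

noncomputable section

section AffineChart

variable {E : Type*} [AddCommGroup E] [Module ℝ E] {T : Submodule ℝ E} {d : ℕ}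
  (b : Module.Basis (Fin d) ℝ T)

/-- The affine coordinates around `p` given by a basis `b` of the direction `T`. -/
def affineChart (p : E) (x : Fin d → ℝ) : E := p + ∑ i, x i • (b i : E)

@[simp]
theorem affineChart_zero (p : E) : affineChart b p 0 = p := by
  simp [affineChart]

theorem affineChart_add_single (p : E) (x : Fin d → ℝ) (i : Fin d) (t : ℝ) :
    affineChart b p (x + t • Pi.single i 1) = affineChart b p x + t • (b i : E) := by
  simp only [affineChart, Pi.add_apply, Pi.smul_apply, add_smul, Finset.sum_add_distrib, add_assoc]
  congr 2
  rw [Finset.sum_eq_single i] <;> simp +contextual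

/-- The `i`-th partial derivative of a map on `ℝᵈ`. -/
def pderiv {F : Type*} [NormedAddCommGroup F] [NormedSpace ℝ F] (i : Fin d)
    (y : (Fin d → ℝ) → F) (x : Fin d → ℝ) : F :=
  fderiv ℝ y x (Pi.single i 1)

section pderiv

variable {F : Type*} [NormedAddCommGroup F] [NormedSpace ℝ F] {y z : (Fin d → ℝ) → F}
  {x : Fin d → ℝ}

theorem contDiffAt_pderiv {m n : WithTop ℕ∞} (hy : ContDiffAt ℝ n y x) (hmn : m + 1 ≤ n)
    (i : Fin d) : ContDiffAt ℝ m (pderiv i y) x :=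
  (hy.fderiv_right hmn).clm_apply contDiffAt_const

theorem differentiableAt_pderiv (hy : ContDiffAt ℝ 2 y x) (i : Fin d) :
    DifferentiableAt ℝ (pderiv i y) x :=
  (contDiffAt_pderiv (m := 1) hy (by norm_num) i).differentiableAt (by norm_num)

theorem pderiv_congr (h : y =ᶠ[𝓝 x] z) (i : Fin d) : pderiv i y x = pderiv i z x := by
  rw [pderiv, pderiv, h.fderiv_eq]

theorem pderiv_comm (hy : ContDiffAt ℝ 2 y x) (i j : Fin d) :
    pderiv i (pderiv j y) x = pderiv j (pderiv i y) x := by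
  have hd : DifferentiableAt ℝ (fderiv ℝ y) x :=
    (hy.fderiv_right (m := 1) (by norm_num)).differentiableAt (by norm_num)
  have second (i j : Fin d) : pderiv i (pderiv j y) x
      = fderiv ℝ (fderiv ℝ y) x (Pi.single i 1) (Pi.single j 1) := by
    unfold pderiv
    rw [fderiv_clm_apply hd (by fun_prop)]
    simp
  rw [second, second, (hy.isSymmSndFDerivAt (by simp)).eq]

theorem pderiv_inner {F : Type*} [NormedAddCommGroup F] [InnerProductSpace ℝ F]
    {u v : (Fin d → ℝ) → F} (hu : DifferentiableAt ℝ u x) (hv : DifferentiableAt ℝ v x)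
    (i : Fin d) :
    pderiv i (fun z => inner ℝ (u z) (v z)) x
      = inner ℝ (u x) (pderiv i v x) + inner ℝ (pderiv i u x) (v x) :=
  fderiv_inner_apply ℝ hu hv _

variable {b} in
theorem dirDeriv_affineChart {p : E} {u : E → F}
    (h : (fun z => u (affineChart b p z)) =ᶠ[𝓝 x] y) (hy : DifferentiableAt ℝ y x) (i : Fin d) :
    dirDeriv u (affineChart b p x) (b i : E) = pderiv i y x := by
  have line : Tendsto (fun t : ℝ => x + t • (Pi.single i 1 : Fin d → ℝ)) (𝓝 0) (𝓝 x) := by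
    have : Continuous fun t : ℝ => x + t • (Pi.single i 1 : Fin d → ℝ) := by fun_prop
    simpa only [zero_smul, add_zero] using this.tendsto 0
  have restrict : (fun t : ℝ => u (affineChart b p x + t • (b i : E)))
      =ᶠ[𝓝 0] fun t : ℝ => y (x + t • Pi.single i 1) := by
    filter_upwards [line.eventually h] with t ht
    rw [← ht, affineChart_add_single]
  rw [dirDeriv, restrict.deriv_eq]
  exact hy.lineDeriv_eq_fderiv

end pderiv

end AffineChart

section MatrixSmooth

attribute [local instance] Matrix.linftyOpNormedRing Matrix.linftyOpNormedAlgebra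

theorem contDiffAt_matrix_inv_apply {m X : Type*} [Fintype m] [DecidableEq m]
    [NormedAddCommGroup X] [NormedSpace ℝ X] {N : WithTop ℕ∞} {G : X → Matrix m m ℝ} {x : X}
    (hG : ∀ i j, ContDiffAt ℝ N (fun z => G z i j) x) (hdet : (G x).det ≠ 0) (i j : m) :
    ContDiffAt ℝ N (fun z => (G z)⁻¹ i j) x := by
  have hGx : IsUnit (G x) := (Matrix.isUnit_iff_isUnit_det _).2 hdet.isUnit
  have entries : ContDiffAt ℝ N G x := by
    let ofEntries := (Matrix.ofLinearEquiv (m := m) (n := m) (α := ℝ) ℝ).toLinearMap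
    exact ofEntries.toContinuousLinearMap.contDiff.contDiffAt.comp x
      (contDiffAt_pi.2 fun i => contDiffAt_pi.2 fun j => hG i j)
  have inverse : ContDiffAt ℝ N (fun z => (G z)⁻¹) x := by
    simp only [Matrix.nonsing_inv_eq_ringInverse]
    have ringInverse : ContDiffAt ℝ N Ring.inverse (G x) :=
      hGx.unit_spec ▸ contDiffAt_ringInverse ℝ hGx.unit
    exact ringInverse.comp x entries
  exact (Matrix.entryLinearMap ℝ ℝ i j).toContinuousLinearMap.contDiff.contDiffAt.comp x inverse

end MatrixSmooth

section Gauss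

variable {E : Type*} [AddCommGroup E] [Module ℝ E] {T : Submodule ℝ E} {d : ℕ}
  {b : Module.Basis (Fin d) ℝ T} {F : Type*} [NormedAddCommGroup F] [InnerProductSpace ℝ F]
  {g : E → E → E → ℝ} {p : E}

section Definitions

variable (y : (Fin d → ℝ) → F)

/-- The matrix of the metric induced by an immersion `y` of `ℝᵈ`. -/
def inducedMetric (x : Fin d → ℝ) : Matrix (Fin d) (Fin d) ℝ :=
  Matrix.gram ℝ fun i => pderiv i y x

/-- The Christoffel symbols `Γ_ij^k` of the metric induced by an immersion `y`, expressed by the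
tangential part of `∂ᵢ∂ⱼ y`. -/
def inducedChristoffel (i j k : Fin d) (x : Fin d → ℝ) : ℝ :=
  ∑ m, (inducedMetric y x)⁻¹ k m * inner ℝ (pderiv i (pderiv j y) x) (pderiv m y x)

/-- The second fundamental form `II(∂ᵢ, ∂ⱼ)` of an immersion `y`: the normal part of `∂ᵢ∂ⱼ y`. -/
def secondFundamentalForm (i j : Fin d) (x : Fin d → ℝ) : F :=
  pderiv i (pderiv j y) x - ∑ k, inducedChristoffel y i j k x • pderiv k y x

end Definitions

variable {y : (Fin d → ℝ) → F} {x : Fin d → ℝ}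

theorem det_inducedMetric_ne_zero (hli : LinearIndependent ℝ fun i => pderiv i y x) :
    (inducedMetric y x).det ≠ 0 :=
  Matrix.det_gram_ne_zero_iff_linearIndependent.2 hli

theorem sum_inducedMetric_mul_inducedChristoffel
    (hli : LinearIndependent ℝ fun i => pderiv i y x) (i j m : Fin d) :
    ∑ k, inducedMetric y x m k * inducedChristoffel y i j k x
      = inner ℝ (pderiv i (pderiv j y) x) (pderiv m y x) := by
  have := congrFun (Matrix.mulVec_mulVec
    (fun l => inner ℝ (pderiv i (pderiv j y) x) (pderiv l y x))
    (inducedMetric y x) (inducedMetric y x)⁻¹) m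
  rwa [Matrix.mul_nonsing_inv _ (det_inducedMetric_ne_zero hli).isUnit, Matrix.one_mulVec] at this

theorem inner_secondFundamentalForm_pderiv (hli : LinearIndependent ℝ fun i => pderiv i y x)
    (i j m : Fin d) : inner ℝ (secondFundamentalForm y i j x) (pderiv m y x) = 0 := by
  simp only [secondFundamentalForm, inner_sub_left, sum_inner, real_inner_smul_left]
  rw [← sum_inducedMetric_mul_inducedChristoffel hli, sub_eq_zero]
  exact Finset.sum_congr rfl fun k _ => by
    rw [mul_comm, real_inner_comm, inducedMetric, Matrix.gram_apply]

theorem inner_secondFundamentalForm_pderiv_pderiv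
    (hli : LinearIndependent ℝ fun i => pderiv i y x) (i j k l : Fin d) :
    inner ℝ (secondFundamentalForm y i j x) (pderiv k (pderiv l y) x)
      = inner ℝ (secondFundamentalForm y i j x) (secondFundamentalForm y k l x) := by
  rw [secondFundamentalForm.eq_1 y k l x, inner_sub_right, inner_sum]
  simp only [real_inner_smul_right, inner_secondFundamentalForm_pderiv hli, mul_zero,
    Finset.sum_const_zero, sub_zero]

theorem contDiffAt_inducedMetric_apply (hy : ContDiffAt ℝ 3 y x) (i j : Fin d) :
    ContDiffAt ℝ 2 (fun z => inducedMetric y z i j) x :=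
  (contDiffAt_pderiv hy (by norm_num) i).inner ℝ (contDiffAt_pderiv hy (by norm_num) j)

theorem eventually_linearIndependent_pderiv (hy : ContDiffAt ℝ 3 y x)
    (hli : LinearIndependent ℝ fun i => pderiv i y x) :
    ∀ᶠ z in 𝓝 x, LinearIndependent ℝ fun i => pderiv i y z :=
  have continuousAt_pderiv : ContinuousAt (fun z i => pderiv i y z) x :=
    continuousAt_pi.2 fun i => (contDiffAt_pderiv (m := 2) hy (by norm_num) i).continuousAt
  continuousAt_pderiv.eventually hli.eventually

theorem differentiableAt_inducedChristoffel (hy : ContDiffAt ℝ 3 y x)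
    (hli : LinearIndependent ℝ fun i => pderiv i y x) (i j k : Fin d) :
    DifferentiableAt ℝ (inducedChristoffel y i j k) x := by
  have first (m : Fin d) : ContDiffAt ℝ 2 (pderiv m y) x := contDiffAt_pderiv hy (by norm_num) m
  exact DifferentiableAt.fun_sum fun m _ =>
    ((contDiffAt_matrix_inv_apply (contDiffAt_inducedMetric_apply hy)
      (det_inducedMetric_ne_zero hli) k m).differentiableAt (by norm_num)).mul
    ((differentiableAt_pderiv (first j) i).inner ℝ ((first m).differentiableAt (by norm_num)))

theorem hasFDerivAt_secondFundamentalForm (hy : ContDiffAt ℝ 3 y x)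
    (hli : LinearIndependent ℝ fun i => pderiv i y x) (j k : Fin d) :
    HasFDerivAt (secondFundamentalForm y j k)
      (fderiv ℝ (pderiv j (pderiv k y)) x - ∑ l,
        (inducedChristoffel y j k l x • fderiv ℝ (pderiv l y) x
          + (fderiv ℝ (inducedChristoffel y j k l) x).smulRight (pderiv l y x))) x :=
  (differentiableAt_pderiv (contDiffAt_pderiv hy (by norm_num) k) j).hasFDerivAt.sub
    (HasFDerivAt.fun_sum fun l _ =>
      (differentiableAt_inducedChristoffel hy hli j k l).hasFDerivAt.smul
        (differentiableAt_pderiv (hy.of_le (by norm_num)) l).hasFDerivAt)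

theorem inner_pderiv_secondFundamentalForm_pderiv (hy : ContDiffAt ℝ 3 y x)
    (hli : LinearIndependent ℝ fun i => pderiv i y x) (i j k m : Fin d) :
    inner ℝ (pderiv i (secondFundamentalForm y j k) x) (pderiv m y x)
      = -inner ℝ (secondFundamentalForm y j k x) (secondFundamentalForm y i m x) := by
  have normal : (fun z => inner ℝ (secondFundamentalForm y j k z) (pderiv m y z))
      =ᶠ[𝓝 x] fun _ => 0 :=
    (eventually_linearIndependent_pderiv hy hli).mono fun z hz =>
      inner_secondFundamentalForm_pderiv hz j k m
  rw [eq_neg_iff_add_eq_zero, add_comm, ← inner_secondFundamentalForm_pderiv_pderiv hli,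
    ← pderiv_inner (hasFDerivAt_secondFundamentalForm hy hli j k).differentiableAt
      (differentiableAt_pderiv (hy.of_le (by norm_num)) m), pderiv_congr normal]
  simp [pderiv]

theorem sum_inducedMetric_mul_pderiv_inducedChristoffel (hy : ContDiffAt ℝ 3 y x)
    (hli : LinearIndependent ℝ fun i => pderiv i y x) (i j k m : Fin d) :
    ∑ l, inducedMetric y x m l * (pderiv i (inducedChristoffel y j k l) x +
        ∑ q, inducedChristoffel y j k q x * inducedChristoffel y i q l x)
      = inner ℝ (pderiv i (pderiv j (pderiv k y)) x) (pderiv m y x)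
        + inner ℝ (secondFundamentalForm y j k x) (secondFundamentalForm y i m x) := by
  have weingarten := inner_pderiv_secondFundamentalForm_pderiv hy hli i j k m
  have derivative : pderiv i (secondFundamentalForm y j k) x
      = pderiv i (pderiv j (pderiv k y)) x - ∑ l,
        (inducedChristoffel y j k l x • pderiv i (pderiv l y) x
          + pderiv i (inducedChristoffel y j k l) x • pderiv l y x) := by
    simp [pderiv, (hasFDerivAt_secondFundamentalForm hy hli j k).fderiv]
  simp only [derivative, inner_sub_left, sum_inner, inner_add_left, real_inner_smul_left,
    ← sum_inducedMetric_mul_inducedChristoffel hli, Finset.sum_add_distrib] at weingarten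
  have exchange : ∑ l, inducedMetric y x m l *
        ∑ q, inducedChristoffel y j k q x * inducedChristoffel y i q l x
      = ∑ q, inducedChristoffel y j k q x *
        ∑ l, inducedMetric y x m l * inducedChristoffel y i q l x := by
    simp only [Finset.mul_sum]
    rw [Finset.sum_comm]
    exact Finset.sum_congr rfl fun q _ => Finset.sum_congr rfl fun l _ => by ring
  have lower : ∑ l, inducedMetric y x m l * pderiv i (inducedChristoffel y j k l) x
      = ∑ l, pderiv i (inducedChristoffel y j k l) x * inner ℝ (pderiv l y x) (pderiv m y x) :=
    Finset.sum_congr rfl fun l _ => by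
      rw [mul_comm, real_inner_comm, inducedMetric, Matrix.gram_apply]
  simp only [mul_add, Finset.sum_add_distrib]
  rw [exchange, lower]
  linarith

section InducedMetric

variable (hy : ContDiffAt ℝ 3 y 0)
  (hg : (fun x => metricTensor b g (affineChart b p x)) =ᶠ[𝓝 0] inducedMetric y)

include hy hg

theorem eventually_partialDeriv_metricTensor :
    ∀ᶠ x in 𝓝 0, ∀ i j k,
      partialDeriv b i (fun q => metricTensor b g q j k) (affineChart b p x) =
        inner ℝ (pderiv j y x) (pderiv i (pderiv k y) x)
          + inner ℝ (pderiv i (pderiv j y) x) (pderiv k y x) := by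
  filter_upwards [hg.eventually_nhds, hy.eventually (by simp)] with x hgx hyx i j k
  have hd := differentiableAt_pderiv (hyx.of_le (by norm_num : (2 : WithTop ℕ∞) ≤ 3))
  rw [← pderiv_inner (hd j) (hd k), partialDeriv]
  exact dirDeriv_affineChart (hgx.mono fun z hz => congrFun (congrFun hz j) k)
    ((hd j).inner ℝ (hd k)) i

theorem eventually_christoffel_eq_inducedChristoffel :
    ∀ᶠ x in 𝓝 0, ∀ i j k,
      christoffel b g i j k (affineChart b p x) = inducedChristoffel y i j k x := by
  filter_upwards [hg, eventually_partialDeriv_metricTensor hy hg, hy.eventually (by simp)]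
    with x hgx hdx hyx i j k
  have comm := pderiv_comm (hyx.of_le (by norm_num : (2 : WithTop ℕ∞) ≤ 3))
  rw [christoffel, inducedChristoffel, Finset.mul_sum]
  refine Finset.sum_congr rfl fun m _ => ?_
  rw [hgx, hdx, hdx, hdx, comm j i, comm m i, comm m j,
    real_inner_comm (pderiv i (pderiv m y) x), real_inner_comm (pderiv j (pderiv m y) x)]
  ring

theorem gauss_equation (hli : LinearIndependent ℝ fun i => pderiv i y 0)
    (i j k l : Fin d) :
    riemannTensor b g i j k l p = ∑ m, (inducedMetric y 0)⁻¹ l m *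
      (inner ℝ (secondFundamentalForm y j k 0) (secondFundamentalForm y i m 0)
        - inner ℝ (secondFundamentalForm y i k 0) (secondFundamentalForm y j m 0)) := by
  have hΓ := eventually_christoffel_eq_inducedChristoffel hy hg
  have hΓ0 (i j k : Fin d) : christoffel b g i j k p = inducedChristoffel y i j k 0 := by
    simpa only [affineChart_zero] using hΓ.self_of_nhds i j k
  have hdΓ (i j k l : Fin d) : partialDeriv b i (christoffel b g j k l) p
      = pderiv i (inducedChristoffel y j k l) 0 := by
    have := dirDeriv_affineChart (hΓ.mono fun z hz => hz j k l)
      (differentiableAt_inducedChristoffel hy hli j k l) i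
    rwa [affineChart_zero] at this
  have lowered : (inducedMetric y 0).mulVec (fun l => riemannTensor b g i j k l p)
      = fun m => inner ℝ (secondFundamentalForm y j k 0) (secondFundamentalForm y i m 0)
        - inner ℝ (secondFundamentalForm y i k 0) (secondFundamentalForm y j m 0) := by
    funext m
    have hi := sum_inducedMetric_mul_pderiv_inducedChristoffel hy hli i j k m
    have hj := sum_inducedMetric_mul_pderiv_inducedChristoffel hy hli j i k m
    have hyk : ContDiffAt ℝ 2 (pderiv k y) 0 := contDiffAt_pderiv hy (by norm_num) k
    rw [pderiv_comm hyk j i] at hj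
    rw [← add_sub_add_left_eq_sub _ _ (inner ℝ (pderiv i (pderiv j (pderiv k y)) 0) (pderiv m y 0)),
      ← hi, ← hj, ← Finset.sum_sub_distrib, Matrix.mulVec, dotProduct]
    refine Finset.sum_congr rfl fun l _ => ?_
    simp only [riemannTensor, hdΓ, hΓ0, Finset.sum_sub_distrib]
    ring
  have := congrArg (inducedMetric y 0)⁻¹.mulVec lowered
  rw [Matrix.mulVec_mulVec, Matrix.nonsing_inv_mul _ (det_inducedMetric_ne_zero hli).isUnit,
    Matrix.one_mulVec] at this
  exact congrFun this l

end InducedMetric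

end Gauss

section Hypersurface

open Matrix

theorem mul_inv_gram_mul_transpose {ι κ : Type*} [Fintype ι] [DecidableEq ι] [Fintype κ]
    [DecidableEq κ] {e : Matrix ι κ ℝ} {n : ι → ℝ} (hdet : (eᵀ * e).det ≠ 0) (hn : n ⬝ᵥ n ≠ 0)
    (horth : eᵀ *ᵥ n = 0) (hspan : ∀ v, eᵀ *ᵥ v = 0 → ∃ s : ℝ, v = s • n) :
    e * (eᵀ * e)⁻¹ * eᵀ = 1 - (n ⬝ᵥ n)⁻¹ • vecMulVec n n := by
  set P := e * (eᵀ * e)⁻¹ * eᵀ with hP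
  have hPT : Pᵀ = P := by
    simp [hP, transpose_mul, transpose_nonsing_inv, Matrix.mul_assoc]
  have heP : eᵀ * P = eᵀ := by
    rw [hP, ← Matrix.mul_assoc, ← Matrix.mul_assoc, mul_nonsing_inv _ hdet.isUnit, Matrix.one_mul]
  have hPn : P *ᵥ n = 0 := by rw [hP, ← mulVec_mulVec, horth, mulVec_zero]
  have normalPart (v : ι → ℝ) : v - P *ᵥ v = ((n ⬝ᵥ n)⁻¹ * (n ⬝ᵥ v)) • n := by
    obtain ⟨s, hs⟩ := hspan (v - P *ᵥ v) (by rw [mulVec_sub, mulVec_mulVec, heP, sub_self])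
    have hnP : n ⬝ᵥ P *ᵥ v = 0 := by
      rw [dotProduct_mulVec, ← mulVec_transpose, hPT, hPn, zero_dotProduct]
    have := congrArg (n ⬝ᵥ ·) hs
    simp only [dotProduct_sub, hnP, sub_zero, dotProduct_smul, smul_eq_mul] at this
    rw [hs, this, mul_left_comm, inv_mul_cancel₀ hn, mul_one]
  rw [eq_sub_iff_add_eq, ← eq_sub_iff_add_eq']
  refine ext_iff_mulVec.2 fun v => ?_
  rw [sub_mulVec, one_mulVec, normalPart, smul_mulVec, vecMulVec_mulVec,
    op_smul_eq_smul, smul_smul]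

variable {E : Type*} [AddCommGroup E] [Module ℝ E] {T : Submodule ℝ E} {d : ℕ}
  {b : Module.Basis (Fin d) ℝ T} {g : E → E → E → ℝ} {p : E}

section InnerProductSpace

variable {F : Type*} [NormedAddCommGroup F] [InnerProductSpace ℝ F] {y N : (Fin d → ℝ) → F}
  {x : Fin d → ℝ} {n : F}

theorem secondFundamentalForm_eq_smul (hli : LinearIndependent ℝ fun i => pderiv i y x)
    (hn : ∀ i, inner ℝ (pderiv i y x) n = 0)
    (hspan : ∀ v, (∀ i, inner ℝ (pderiv i y x) v = 0) → v ∈ Submodule.span ℝ {n}) (i j : Fin d) :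
    secondFundamentalForm y i j x = (inner ℝ (pderiv i (pderiv j y) x) n / ‖n‖ ^ 2) • n := by
  have orthogonal (m : Fin d) : inner ℝ (pderiv m y x) (secondFundamentalForm y i j x) = 0 := by
    rw [real_inner_comm, inner_secondFundamentalForm_pderiv hli]
  obtain ⟨s, hs⟩ := Submodule.mem_span_singleton.1 (hspan _ orthogonal)
  have normalPart : inner ℝ (secondFundamentalForm y i j x) n
      = inner ℝ (pderiv i (pderiv j y) x) n := by
    simp [secondFundamentalForm, inner_sub_left, sum_inner, real_inner_smul_left, hn]
  rw [← normalPart, ← hs, real_inner_smul_left, real_inner_self_eq_norm_sq]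
  rcases eq_or_ne n 0 with rfl | hn0
  · simp
  · rw [mul_div_cancel_right₀ _ (pow_ne_zero 2 (norm_ne_zero_iff.2 hn0))]

theorem inner_pderiv_pderiv_normal (hy : ContDiffAt ℝ 2 y x) (hN : DifferentiableAt ℝ N x)
    (horth : ∀ᶠ z in 𝓝 x, ∀ i, inner ℝ (pderiv i y z) (N z) = 0) (i j : Fin d) :
    inner ℝ (pderiv i (pderiv j y) x) (N x) = -inner ℝ (pderiv j y x) (pderiv i N x) := by
  have product := pderiv_inner (differentiableAt_pderiv hy j) hN i
  rw [pderiv_congr (horth.mono fun z hz => hz j : _ =ᶠ[𝓝 x] fun _ => (0 : ℝ))] at product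
  rw [eq_neg_iff_add_eq_zero, add_comm, ← product]
  simp [pderiv]

theorem scalarCurvature_eq_trace_sq_sub_trace_sq (hy : ContDiffAt ℝ 3 y 0)
    (hg : (fun x => metricTensor b g (affineChart b p x)) =ᶠ[𝓝 0] inducedMetric y)
    (hli : LinearIndependent ℝ fun i => pderiv i y 0) {h : Matrix (Fin d) (Fin d) ℝ} {c : ℝ}
    (hsymm : h.IsSymm)
    (hh : ∀ i j k l, inner ℝ (secondFundamentalForm y i j 0) (secondFundamentalForm y k l 0)
      = h i j * h k l * c) :
    scalarCurvature b g p =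
      (((inducedMetric y 0)⁻¹ * h).trace ^ 2
        - ((inducedMetric y 0)⁻¹ * h * ((inducedMetric y 0)⁻¹ * h)).trace) * c := by
  have hG : metricTensor b g p = inducedMetric y 0 := by
    simpa only [affineChart_zero] using hg.self_of_nhds
  have hsymm' (i j : Fin d) : h i j = h j i := hsymm.apply j i
  simp only [scalarCurvature, ricciTensor, gauss_equation hy hg hli, hG, hh]
  generalize (inducedMetric y 0)⁻¹ = K
  have traceMul : (K * h).trace = ∑ i, ∑ m, K i m * h i m := by
    simp only [trace, diag, mul_apply]
    exact Finset.sum_congr rfl fun i _ => Finset.sum_congr rfl fun m _ => by rw [hsymm' m i]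
  have sandwich (j k : Fin d) : ∑ i, ∑ m, K i m * (h i k * h j m) = (h * K * h) k j := by
    simp only [mul_apply, Finset.sum_mul]
    rw [Finset.sum_comm]
    exact Finset.sum_congr rfl fun m _ => Finset.sum_congr rfl fun i _ => by
      rw [hsymm' i k, hsymm' j m]; ring
  have traceMulSq : (K * h * (K * h)).trace = ∑ j, ∑ k, K j k * (h * K * h) k j := by
    rw [Matrix.mul_assoc, ← Matrix.mul_assoc h]
    rfl
  rw [traceMulSq, sq]
  simp only [← sandwich, traceMul, Finset.mul_sum, Finset.sum_mul, ← Finset.sum_sub_distrib]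
  iterate 4 refine Finset.sum_congr rfl fun _ _ => ?_
  ring

end InnerProductSpace

variable {ι : Type*} [Fintype ι] [DecidableEq ι]

theorem trace_sq_sub_trace_sq_of_projection {κ : Type*} [Fintype κ]
    {e : Matrix ι κ ℝ} {n : ι → ℝ} {K : Matrix κ κ ℝ} {c : ℝ}
    (hK : e * K * eᵀ = 1 - c • vecMulVec n n) (ρ : ι → ℝ) :
    (K * (eᵀ * diagonal ρ * e)).trace ^ 2
        - (K * (eᵀ * diagonal ρ * e) * (K * (eᵀ * diagonal ρ * e))).trace
      = ∑ a, ∑ k ∈ Finset.univ.erase a, ρ a * ρ k * (1 - c * n a ^ 2 - c * n k ^ 2) := by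
  have cyclic : (K * (eᵀ * diagonal ρ * e)).trace = (e * K * eᵀ * diagonal ρ).trace := by
    rw [← Matrix.mul_assoc, Matrix.trace_mul_comm]
    simp only [Matrix.mul_assoc]
  have cyclicSq : (K * (eᵀ * diagonal ρ * e) * (K * (eᵀ * diagonal ρ * e))).trace
      = (e * K * eᵀ * diagonal ρ * (e * K * eᵀ * diagonal ρ)).trace := by
    rw [← Matrix.mul_assoc, ← Matrix.mul_assoc, Matrix.trace_mul_comm]
    simp only [Matrix.mul_assoc]
  have entry (a k : ι) : (e * K * eᵀ * diagonal ρ) a k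
      = ((if a = k then 1 else 0) - c * (n a * n k)) * ρ k := by
    simp [hK, mul_diagonal, vecMulVec_apply, one_apply]
  rw [cyclic, cyclicSq, trace, trace, sq, Finset.sum_mul_sum, ← Finset.sum_sub_distrib]
  refine Finset.sum_congr rfl fun a _ => ?_
  simp only [diag_apply, mul_apply (M := e * K * eᵀ * diagonal ρ), ← Finset.sum_sub_distrib, entry]
  rw [← Finset.add_sum_erase _ _ (Finset.mem_univ a)]
  simp only [↓reduceIte, sub_self, zero_add]
  refine Finset.sum_congr rfl fun k hk => ?_
  simp only [Finset.ne_of_mem_erase hk, (Finset.ne_of_mem_erase hk).symm, if_false]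
  ring

theorem scalarCurvature_hypersurface {y N : (Fin d → ℝ) → EuclideanSpace ℝ ι} {ρ : ι → ℝ}
    (hy : ContDiffAt ℝ 3 y 0)
    (hg : (fun x => metricTensor b g (affineChart b p x)) =ᶠ[𝓝 0] inducedMetric y)
    (hli : LinearIndependent ℝ fun i => pderiv i y 0) (hN : DifferentiableAt ℝ N 0)
    (horth : ∀ᶠ x in 𝓝 0, ∀ i, inner ℝ (pderiv i y x) (N x) = 0) (hN0 : N 0 ≠ 0)
    (hspan : ∀ v, (∀ i, inner ℝ (pderiv i y 0) v = 0) → v ∈ Submodule.span ℝ {N 0})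
    (hρ : ∀ i a, pderiv i N 0 a = ρ a * pderiv i y 0 a) :
    scalarCurvature b g p =
      (∑ a, ∑ k ∈ Finset.univ.erase a,
        ρ a * ρ k * (1 - N 0 a ^ 2 / ‖N 0‖ ^ 2 - N 0 k ^ 2 / ‖N 0‖ ^ 2)) / ‖N 0‖ ^ 2 := by
  set e : Matrix ι (Fin d) ℝ := of fun a i => pderiv i y 0 a with he
  set n : ι → ℝ := ⇑(N 0) with hn
  have inner_eq (v : EuclideanSpace ℝ ι) (i : Fin d) : inner ℝ (pderiv i y 0) v = (eᵀ *ᵥ ⇑v) i := by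
    simp [PiLp.inner_apply, mulVec, dotProduct, he, mul_comm]
  have gram : inducedMetric y 0 = eᵀ * e := by
    ext i j
    simp [inducedMetric, mul_apply, he, PiLp.inner_apply, mul_comm]
  have norm_sq : n ⬝ᵥ n = ‖N 0‖ ^ 2 := by
    simp only [EuclideanSpace.real_norm_sq_eq, dotProduct, hn, ← sq]
  have norm_ne : ‖N 0‖ ^ 2 ≠ 0 := pow_ne_zero 2 (norm_ne_zero_iff.2 hN0)
  have projection : e * (inducedMetric y 0)⁻¹ * eᵀ = 1 - (‖N 0‖ ^ 2)⁻¹ • vecMulVec n n := by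
    rw [gram, ← norm_sq]
    refine mul_inv_gram_mul_transpose (gram ▸ det_inducedMetric_ne_zero hli) (norm_sq ▸ norm_ne)
      (funext fun i => by rw [← inner_eq]; exact horth.self_of_nhds i) fun v hv => ?_
    obtain ⟨s, hs⟩ := Submodule.mem_span_singleton.1
      (hspan (WithLp.toLp 2 v) fun i => by rw [inner_eq]; exact congrFun hv i)
    exact ⟨s, (congrArg WithLp.ofLp hs).symm⟩
  have shape (i j : Fin d) :
      inner ℝ (pderiv i (pderiv j y) 0) (N 0) = -(eᵀ * diagonal ρ * e) i j := by
    rw [inner_pderiv_pderiv_normal (hy.of_le (by norm_num)) hN horth, mul_apply,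
      PiLp.inner_apply]
    simp only [mul_diagonal, hρ, he, transpose_apply, of_apply, RCLike.inner_apply, conj_trivial]
    refine congrArg Neg.neg (Finset.sum_congr rfl fun a _ => ?_)
    ring
  have gauss (i j k l : Fin d) :
      inner ℝ (secondFundamentalForm y i j 0) (secondFundamentalForm y k l 0)
        = (eᵀ * diagonal ρ * e) i j * (eᵀ * diagonal ρ * e) k l * (‖N 0‖ ^ 2)⁻¹ := by
    simp only [secondFundamentalForm_eq_smul hli horth.self_of_nhds hspan, shape,
      real_inner_smul_left, real_inner_smul_right, real_inner_self_eq_norm_sq]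
    field_simp
  have symm : (eᵀ * diagonal ρ * e).IsSymm := by
    simp [IsSymm, transpose_mul, Matrix.mul_assoc]
  rw [scalarCurvature_eq_trace_sq_sub_trace_sq hy hg hli symm gauss,
    trace_sq_sub_trace_sq_of_projection projection]
  simp only [div_eq_inv_mul, mul_comm _ (‖N 0‖ ^ 2)⁻¹]

end Hypersurface

section AdaptedCoordinates

variable {E : Type*} [AddCommGroup E] [Module ℝ E] {T : Submodule ℝ E} {d : ℕ}
  {b : Module.Basis (Fin d) ℝ T} {g : E → E → E → ℝ} {p : E} {ι : Type*}
  {co : E →ₗ[ℝ] EuclideanSpace ℝ ι} {s : ι → ℝ} {ε : EuclideanSpace ℝ ι}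

theorem contDiff_linearMap_affineChart {F : Type*} [NormedAddCommGroup F] [NormedSpace ℝ F]
    (L : E →ₗ[ℝ] F) {m : WithTop ℕ∞} :
    ContDiff ℝ m fun x : Fin d → ℝ => L (affineChart b p x) := by
  simp only [affineChart, map_add, map_sum, map_smul]
  fun_prop

section Basis

variable {v : Fin d → EuclideanSpace ℝ ι} (hv : ∀ i a, v i a = s a * co (b i) a)
  (hs : ∀ a, s a ≠ 0)

include hv hs

theorem linearIndependent_of_adapted (hco : Set.InjOn co T) : LinearIndependent ℝ v := by
  refine Fintype.linearIndependent_iff.2 fun c hc => ?_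
  have vanish : co ((∑ i, c i • b i : T) : E) = co (0 : T) := by
    ext a
    have := congrArg (fun u : EuclideanSpace ℝ ι => u a) hc
    simp only [WithLp.ofLp_sum, Finset.sum_apply, PiLp.smul_apply, PiLp.zero_apply, smul_eq_mul, hv,
      mul_left_comm _ (s a), ← Finset.mul_sum, mul_eq_zero, hs a, false_or] at this
    simpa using this
  exact Fintype.linearIndependent_iff.1 b.linearIndependent c
    (Subtype.coe_injective (hco (Subtype.coe_prop _) (Subtype.coe_prop _) vanish))

variable [Fintype ι]

theorem mem_span_of_adapted (hco : Set.SurjOn co T (Submodule.span ℝ {ε})ᗮ)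
    {N u : EuclideanSpace ℝ ι} (hN : ∀ a, N a = ε a / s a) (hu : ∀ i, inner ℝ (v i) u = 0) :
    u ∈ Submodule.span ℝ {N} := by
  set u' : EuclideanSpace ℝ ι := WithLp.toLp 2 fun a => s a * u a
  have orth : ∀ X : T, inner ℝ u' (co X) = 0 := by
    refine LinearMap.congr_fun (f := innerₛₗ ℝ u' ∘ₗ co ∘ₗ T.subtype) (g := 0) (b.ext fun i => ?_)
    rw [LinearMap.zero_apply, ← hu i]
    simp only [LinearMap.comp_apply, Submodule.subtype_apply, innerₛₗ_apply_apply,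
      PiLp.inner_apply, RCLike.inner_apply, conj_trivial, hv, u']
    exact Finset.sum_congr rfl fun a _ => by ring
  have : u' ∈ (Submodule.span ℝ {ε})ᗮᗮ := fun w hw => by
    obtain ⟨X, hX, rfl⟩ := hco hw
    rw [real_inner_comm, orth ⟨X, hX⟩]
  rw [Submodule.orthogonal_orthogonal] at this
  obtain ⟨r, hr⟩ := Submodule.mem_span_singleton.1 this
  refine Submodule.mem_span_singleton.2 ⟨r, PiLp.ext fun a => ?_⟩
  have : r * ε a = s a * u a := congrArg (· a) hr
  rw [PiLp.smul_apply, smul_eq_mul, hN, ← mul_div_assoc, this, mul_div_cancel_left₀ _ (hs a)]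

end Basis

variable [Fintype ι] [DecidableEq ι]

theorem scalarCurvature_pullback_of_adapted {u N : E → EuclideanSpace ℝ ι} {ρ : ι → ℝ}
    (hu : ContDiffAt ℝ 3 (fun x => u (affineChart b p x)) 0)
    (hg : ∀ᶠ x in 𝓝 0, ∀ X ∈ T, ∀ Y ∈ T, g (affineChart b p x) X Y
      = inner ℝ (dirDeriv u (affineChart b p x) X) (dirDeriv u (affineChart b p x) Y))
    (hN : DifferentiableAt ℝ (fun x => N (affineChart b p x)) 0)
    (horth : ∀ᶠ x in 𝓝 0, ∀ X ∈ T,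
      inner ℝ (dirDeriv u (affineChart b p x) X) (N (affineChart b p x)) = 0)
    (hs : ∀ a, s a ≠ 0) (hε : ε ≠ 0) (hco : Set.BijOn co T (Submodule.span ℝ {ε})ᗮ)
    (hdu : ∀ X ∈ T, ∀ a, dirDeriv u p X a = s a * co X a)
    (hdN : ∀ X ∈ T, ∀ a, dirDeriv N p X a = ρ a * dirDeriv u p X a)
    (hNp : ∀ a, N p a = ε a / s a) :
    scalarCurvature b g p =
      (∑ a, ∑ k ∈ Finset.univ.erase a,
        ρ a * ρ k * (1 - N p a ^ 2 / ‖N p‖ ^ 2 - N p k ^ 2 / ‖N p‖ ^ 2)) / ‖N p‖ ^ 2 := by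
  set y := fun x => u (affineChart b p x)
  have hdy : ∀ᶠ x in 𝓝 0, ∀ i, dirDeriv u (affineChart b p x) (b i) = pderiv i y x := by
    filter_upwards [hu.eventually (by simp)] with x hx i
    exact dirDeriv_affineChart .rfl (hx.differentiableAt (by norm_num)) i
  have hdy0 (i : Fin d) : pderiv i y 0 = dirDeriv u p (b i) := by
    rw [← hdy.self_of_nhds, affineChart_zero]
  have hv (i : Fin d) (a : ι) : pderiv i y 0 a = s a * co (b i) a := by
    rw [hdy0, hdu _ (b i).2]
  have hNp0 : N p ≠ 0 := fun h => hε (PiLp.ext fun a => by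
    have := hNp a
    rw [h, PiLp.zero_apply, eq_comm, div_eq_zero_iff] at this
    exact this.resolve_right (hs a))
  have := scalarCurvature_hypersurface (b := b) (g := g) (p := p) (ρ := ρ)
    (N := fun x => N (affineChart b p x)) hu
    (by
      filter_upwards [hg, hdy] with x hgx hx
      ext i j
      simp [metricTensor, hgx _ (b i).2 _ (b j).2, hx, inducedMetric])
    (linearIndependent_of_adapted hv hs hco.injOn) hN
    (by filter_upwards [horth, hdy] with x hox hx i; rw [← hx, hox _ (b i).2])
    (by rwa [affineChart_zero])
    (fun u hu => mem_span_of_adapted hv hs hco.surjOn (by simpa using hNp) hu)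
    (fun i a => by
      rw [hdy0, ← hdN _ (b i).2, ← dirDeriv_affineChart .rfl hN, affineChart_zero])
  simpa only [affineChart_zero] using this

end AdaptedCoordinates

section Formula

variable {n : ℕ} {f : ℝ → ℝ} {l : Fin n → ℝ}

theorem cNorm_ne_zero [NeZero n] (hf' : ∀ k, deriv f (l k) ≠ 0) : cNorm f l ≠ 0 := by
  refine (Real.sqrt_pos.2 (Finset.sum_pos (fun k _ => ?_) Finset.univ_nonempty)).ne'
  have := hf' k
  positivity

theorem rho_self (x : ℝ) : rho f x x = -(deriv (deriv f) x / deriv f x ^ 3) :=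
  if_pos rfl

variable (hc : cNorm f l ≠ 0)

include hc

theorem sum_rho_self_mul_eq_diagSum :
    ∑ k, rho f (l k) (l k) * (1 - (1 / deriv f (l k)) ^ 2 / cNorm f l ^ 2)
      = -(2 / cNorm f l ^ 2) * diagSum f l := by
  rw [diagSum, Finset.mul_sum]
  refine Finset.sum_congr rfl fun k _ => ?_
  rw [rho_self, M₃, M₂, one_div, one_div, inv_pow]
  generalize (deriv f (l k) ^ 2)⁻¹ = u
  field_simp

theorem sum_erase_rho_self_mul_eq_diagDoubleSum :
    ∑ i, ∑ k ∈ Finset.univ.erase i, rho f (l i) (l i) * rho f (l k) (l k) *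
        (1 - (1 / deriv f (l i)) ^ 2 / cNorm f l ^ 2 - (1 / deriv f (l k)) ^ 2 / cNorm f l ^ 2)
      = 4 / cNorm f l ^ 2 * diagDoubleSum f l := by
  rw [diagDoubleSum, Finset.mul_sum]
  refine Finset.sum_congr rfl fun i _ => ?_
  rw [Finset.mul_sum]
  refine Finset.sum_congr rfl fun k _ => ?_
  simp only [rho_self, M₃, M₂, one_div, inv_pow, mul_div_mul_comm]
  generalize (deriv f (l i) ^ 2)⁻¹ = u
  generalize (deriv f (l k) ^ 2)⁻¹ = v
  field_simp
  ring

end Formula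

theorem sum_sum_erase_sumType {α β : Type*} [Fintype α] [Fintype β] [DecidableEq α]
    [DecidableEq β] (r ν : α ⊕ β → ℝ) (hν : ∀ b, ν (.inr b) = 0) :
    ∑ i, ∑ k ∈ Finset.univ.erase i, r i * r k * (1 - ν i - ν k)
      = ∑ i, ∑ k ∈ Finset.univ.erase i, r (.inl i) * r (.inl k) * (1 - ν (.inl i) - ν (.inl k))
        + 2 * (∑ i, r (.inl i) * (1 - ν (.inl i))) * (∑ b, r (.inr b))
        + (∑ b, r (.inr b)) ^ 2 - ∑ b, r (.inr b) ^ 2 := by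
  simp only [Finset.sum_erase_eq_sub (Finset.mem_univ _), Finset.sum_sub_distrib,
    Fintype.sum_sum_type, hν, Finset.sum_add_distrib]
  have cross : ∑ i : α, ∑ k : β, r (.inl i) * r (.inr k) * (1 - ν (.inl i) - 0)
      = (∑ i, r (.inl i) * (1 - ν (.inl i))) * ∑ k, r (.inr k) := by
    rw [Finset.sum_mul_sum]
    exact Finset.sum_congr rfl fun i _ => Finset.sum_congr rfl fun k _ => by ring
  have cross' : ∑ k : β, ∑ i : α, r (.inr k) * r (.inl i) * (1 - 0 - ν (.inl i))
      = (∑ i, r (.inl i) * (1 - ν (.inl i))) * ∑ k, r (.inr k) := by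
    rw [Finset.sum_comm, ← cross]
    exact Finset.sum_congr rfl fun i _ => Finset.sum_congr rfl fun k _ => by ring
  have square : ∑ i : β, ∑ k : β, r (.inr i) * r (.inr k) * (1 - 0 - 0)
      = (∑ k, r (.inr k)) ^ 2 := by
    simp [sq, Finset.sum_mul_sum]
  rw [cross, cross', square]
  simp only [sub_zero, mul_one, ← sq]
  ring

theorem contDiffAt_deriv {f : ℝ → ℝ} {x : ℝ} {m k : WithTop ℕ∞} (hf : ContDiffAt ℝ k f x)
    (hmk : m + 1 ≤ k) : ContDiffAt ℝ m (deriv f) x :=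
  (hf.fderiv_right hmk).clm_apply (contDiffAt_const (c := (1 : ℝ)))

theorem deriv_inv_deriv {f : ℝ → ℝ} {x : ℝ} (hf : DifferentiableAt ℝ (deriv f) x)
    (hf' : deriv f x ≠ 0) : deriv (deriv f)⁻¹ x = rho f x x * deriv f x := by
  rw [deriv_inv'' hf hf', rho_self]
  field_simp

theorem hasDerivAt_linearMap_line {E F : Type*} [AddCommGroup E] [Module ℝ E]
    [NormedAddCommGroup F] [NormedSpace ℝ F] (L : E →ₗ[ℝ] F) (p X : E) :
    HasDerivAt (fun t : ℝ => L (p + t • X)) (L X) 0 := by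
  simpa using ((hasDerivAt_id (0 : ℝ)).smul_const (L X)).const_add (L p)

section Coordinatewise

variable {E : Type*} [AddCommGroup E] [Module ℝ E] {n : ℕ}

/-- The map `q ↦ (f (co₁ q), …, f (coₙ q))`, where `co` are linear coordinates. -/
def mapCoords (co : E →ₗ[ℝ] EuclideanSpace ℝ (Fin n)) (f : ℝ → ℝ) (q : E) :
    EuclideanSpace ℝ (Fin n) :=
  WithLp.toLp 2 fun k => f (co q k)

variable {co : E →ₗ[ℝ] EuclideanSpace ℝ (Fin n)} {f : ℝ → ℝ} {p : E}

theorem dirDeriv_mapCoords (hf : ∀ k, DifferentiableAt ℝ f (co p k)) (X : E) :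
    dirDeriv (mapCoords co f) p X = WithLp.toLp 2 fun k => deriv f (co p k) * co X k := by
  have coordinate (k : Fin n) :
      HasDerivAt (fun t : ℝ => f (co (p + t • X) k)) (deriv f (co p k) * co X k) 0 :=
    HasDerivAt.comp (h₂ := f) 0 (by simpa using (hf k).hasDerivAt)
      (hasDerivAt_linearMap_line (EuclideanSpace.projₗ k ∘ₗ co) p X)
  exact ((PiLp.continuousLinearEquiv 2 ℝ fun _ : Fin n => ℝ).symm.hasFDerivAt.comp_hasDerivAt
    (0 : ℝ) (hasDerivAt_pi.2 coordinate)).deriv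

theorem inner_dirDeriv_mapCoords_inv_deriv (hf : ∀ k, DifferentiableAt ℝ f (co p k))
    (hf' : ∀ k, deriv f (co p k) ≠ 0) (X : E) :
    inner ℝ (dirDeriv (mapCoords co f) p X) (mapCoords co (deriv f)⁻¹ p) = ∑ k, co X k := by
  rw [dirDeriv_mapCoords hf, PiLp.inner_apply]
  refine Finset.sum_congr rfl fun k _ => ?_
  have := hf' k
  simp only [mapCoords, Pi.inv_apply, RCLike.inner_apply, conj_trivial]
  field_simp

theorem norm_mapCoords_inv_deriv : ‖mapCoords co (deriv f)⁻¹ p‖ = cNorm f (co p) := by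
  simp [cNorm, EuclideanSpace.norm_eq, mapCoords]

variable {T : Submodule ℝ E} {d : ℕ} {b : Module.Basis (Fin d) ℝ T} {g : E → E → E → ℝ}

theorem contDiffAt_mapCoords_affineChart {m : WithTop ℕ∞} (hf : ∀ k, ContDiffAt ℝ m f (co p k)) :
    ContDiffAt ℝ m (fun x => mapCoords co f (affineChart b p x)) 0 :=
  (contDiffAt_piLp 2).2 fun k => ContDiffAt.comp (g := f) 0 (by simpa using hf k)
    (contDiff_linearMap_affineChart (EuclideanSpace.projₗ k ∘ₗ co)).contDiffAt

theorem eventually_coords_affineChart {P : ℝ → Prop} (hP : ∀ k, ∀ᶠ t in 𝓝 (co p k), P t) :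
    ∀ᶠ x in 𝓝 0, ∀ k, P (co (affineChart b p x) k) :=
  eventually_all.2 fun k => by
    have := (contDiff_linearMap_affineChart (b := b) (p := p) (m := 0)
      (EuclideanSpace.projₗ k ∘ₗ co)).continuous.tendsto 0
    rw [affineChart_zero] at this
    exact this.eventually (hP k)

theorem affineChart_sub_mem (x : Fin d → ℝ) : affineChart b p x - p ∈ T := by
  rw [affineChart, add_sub_cancel_left]
  exact T.sum_mem fun i _ => T.smul_mem _ (b i).2

theorem scalarCurvature_pullback_mapCoords [NeZero n]
    (hco : Set.BijOn co T {w | ∑ k, w k = 0}) (hf : ∀ k, ContDiffAt ℝ 3 f (co p k))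
    (hf' : ∀ k, deriv f (co p k) ≠ 0)
    (hg : ∀ q, q - p ∈ T → (∀ k, DifferentiableAt ℝ f (co q k)) → ∀ X ∈ T, ∀ Y ∈ T,
      g q X Y = inner ℝ (dirDeriv (mapCoords co f) q X) (dirDeriv (mapCoords co f) q Y)) :
    scalarCurvature b g p = 4 / cNorm f (co p) ^ 4 * diagDoubleSum f (co p) := by
  have hdf (k : Fin n) := (hf k).differentiableAt (by norm_num)
  have hf2 (k : Fin n) : ContDiffAt ℝ 2 (deriv f) (co p k) := contDiffAt_deriv (hf k) (by norm_num)
  have hν (k : Fin n) : ContDiffAt ℝ 2 (deriv f)⁻¹ (co p k) := (hf2 k).inv (hf' k)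
  have near : ∀ᶠ x in 𝓝 0, ∀ k, DifferentiableAt ℝ f (co (affineChart b p x) k) ∧
      deriv f (co (affineChart b p x) k) ≠ 0 := by
    refine eventually_coords_affineChart (P := fun t => DifferentiableAt ℝ f t ∧ deriv f t ≠ 0)
      fun k => .and ?_ ((hf2 k).continuousAt.eventually_ne (hf' k))
    filter_upwards [(hf k).eventually (by simp)] with t ht using ht.differentiableAt (by norm_num)
  rw [scalarCurvature_pullback_of_adapted (u := mapCoords co f) (N := mapCoords co (deriv f)⁻¹)
    (co := co) (s := fun k => deriv f (co p k)) (ε := WithLp.toLp 2 1)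
    (ρ := fun k => rho f (co p k) (co p k)) (contDiffAt_mapCoords_affineChart hf) ?metric
    ((contDiffAt_mapCoords_affineChart hν).differentiableAt (by norm_num)) ?orthogonal hf'
    ?nonzero ?coordinates ?tangent ?normal ?weights, norm_mapCoords_inv_deriv]
  case metric =>
    filter_upwards [near] with x hx
    exact hg _ (affineChart_sub_mem x) fun k => (hx k).1
  case orthogonal =>
    filter_upwards [near] with x hx X hX
    rw [inner_dirDeriv_mapCoords_inv_deriv (fun k => (hx k).1) fun k => (hx k).2]
    exact hco.mapsTo hX
  case nonzero => exact fun h => one_ne_zero (congrFun (congrArg WithLp.ofLp h) (0 : Fin n))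
  case coordinates =>
    convert hco using 1
    ext w
    simp [Submodule.mem_orthogonal_singleton_iff_inner_right, PiLp.inner_apply]
  case tangent => exact fun X _ k => by rw [dirDeriv_mapCoords hdf]
  case normal =>
    intro X _ k
    rw [dirDeriv_mapCoords fun k => (hν k).differentiableAt (by norm_num), dirDeriv_mapCoords hdf]
    simp only [deriv_inv_deriv ((hf2 _).differentiableAt (by norm_num)) (hf' _), mul_assoc]
  case weights => simp [mapCoords]
  · have := sum_erase_rho_self_mul_eq_diagDoubleSum (cNorm_ne_zero hf')
    simp only [mapCoords, Pi.inv_apply, ← one_div]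
    rw [this]
    field_simp

end Coordinatewise

section Alpha

variable (α : ℝ)

theorem hasDerivAt_alphaFun {x : ℝ} (hx : 0 < x) :
    HasDerivAt (alphaFun α) (x ^ (-(1 + α) / 2)) x := by
  by_cases hα : α = 1
  · have log : alphaFun α = Real.log := funext fun t => if_pos hα
    rw [log, hα, show (-(1 + 1) / 2 : ℝ) = -1 by norm_num, Real.rpow_neg_one]
    exact Real.hasDerivAt_log hx.ne'
  · have power : alphaFun α = fun t => 2 / (1 - α) * t ^ ((1 - α) / 2) :=
      funext fun t => if_neg hα
    have : 1 - α ≠ 0 := sub_ne_zero.2 (Ne.symm hα)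
    rw [power]
    refine ((Real.hasDerivAt_rpow_const (Or.inl hx.ne')).const_mul _).congr_deriv ?_
    rw [show (1 - α) / 2 - 1 = -(1 + α) / 2 by ring]
    field_simp

theorem deriv_alphaFun {x : ℝ} (hx : 0 < x) : deriv (alphaFun α) x = x ^ (-(1 + α) / 2) :=
  (hasDerivAt_alphaFun α hx).deriv

theorem deriv_deriv_alphaFun {x : ℝ} (hx : 0 < x) :
    deriv (deriv (alphaFun α)) x = -(1 + α) / 2 * x ^ (-(1 + α) / 2 - 1) := by
  have : deriv (alphaFun α) =ᶠ[𝓝 x] fun t => t ^ (-(1 + α) / 2) := by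
    filter_upwards [lt_mem_nhds hx] with t ht using deriv_alphaFun α ht
  rw [this.deriv_eq]
  exact (Real.hasDerivAt_rpow_const (Or.inl hx.ne')).deriv

theorem contDiffAt_alphaFun {x : ℝ} (hx : 0 < x) {m : WithTop ℕ∞} :
    ContDiffAt ℝ m (alphaFun α) x := by
  unfold alphaFun
  split_ifs
  · exact Real.contDiffAt_log.2 hx.ne'
  · exact contDiffAt_const.mul (Real.contDiffAt_rpow_const_of_ne hx.ne')

theorem one_div_deriv_alphaFun_sq {x : ℝ} (hx : 0 < x) :
    1 / deriv (alphaFun α) x ^ 2 = x ^ (α + 1) := by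
  rw [deriv_alphaFun α hx, one_div, ← Real.rpow_natCast, ← Real.rpow_mul hx.le,
    ← Real.rpow_neg hx.le]
  congr 1
  push_cast
  ring

theorem M₃_div_M₂_pow_alphaFun {x : ℝ} (hx : 0 < x) :
    M₃ (alphaFun α) x / M₂ (alphaFun α) x ^ 3 = -(1 + α) / 4 * x ^ α := by
  rw [M₂, M₃, deriv_alphaFun α hx, deriv_deriv_alphaFun α hx, ← Real.rpow_natCast,
    ← Real.rpow_mul hx.le, mul_div_right_comm, mul_div_assoc, ← Real.rpow_sub hx,
    show -(1 + α) / 2 - 1 - -(1 + α) / 2 * ((3 : ℕ) : ℝ) = α by push_cast; ring]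
  ring

variable {n : ℕ} {θ : Fin n → ℝ}

theorem cNorm_alphaFun (hθ : ∀ k, 0 < θ k) :
    cNorm (alphaFun α) θ = √(∑ k, θ k ^ (α + 1)) := by
  simp only [cNorm, one_div_deriv_alphaFun_sq α (hθ _)]

theorem diagDoubleSum_alphaFun (hθ : ∀ k, 0 < θ k) : diagDoubleSum (alphaFun α) θ =
    (1 + α) ^ 2 / 16 * ∑ t, ∑ s ∈ Finset.univ.erase t, θ t ^ α * θ s ^ α *
      (cNorm (alphaFun α) θ ^ 2 - (θ t ^ (α + 1) + θ s ^ (α + 1))) := by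
  simp only [diagDoubleSum, Finset.mul_sum]
  refine Finset.sum_congr rfl fun t _ => Finset.sum_congr rfl fun s _ => ?_
  rw [mul_div_mul_comm, M₃_div_M₂_pow_alphaFun α (hθ t), M₃_div_M₂_pow_alphaFun α (hθ s), M₂, M₂,
    one_div_deriv_alphaFun_sq α (hθ t), one_div_deriv_alphaFun_sq α (hθ s)]
  ring

theorem neZero_of_mem_probSpace (hθ : θ ∈ probSpace n) : NeZero n :=
  ⟨by rintro rfl; simpa using hθ.2⟩

/-- The identity of `ℝⁿ`, as coordinates with values in the Euclidean space. -/
def euclideanCoords (n : ℕ) : (Fin n → ℝ) →ₗ[ℝ] EuclideanSpace ℝ (Fin n) :=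
  (WithLp.linearEquiv 2 ℝ (Fin n → ℝ)).symm

theorem euclideanCoords_bijective : Function.Bijective (euclideanCoords n) :=
  (WithLp.linearEquiv 2 ℝ (Fin n → ℝ)).symm.bijective

theorem ofLp_euclideanCoords : (euclideanCoords n θ).ofLp = θ := rfl

theorem gAlpha_eq_inner_dirDeriv_mapCoords (hθ : ∀ k, DifferentiableAt ℝ (alphaFun α) (θ k))
    (X Y : Fin n → ℝ) :
    gAlpha α θ X Y = inner ℝ (dirDeriv (mapCoords (euclideanCoords n) (alphaFun α)) θ X)
      (dirDeriv (mapCoords (euclideanCoords n) (alphaFun α)) θ Y) := by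
  have coordinatewise (Z : Fin n → ℝ) : dirDeriv (fun (η : Fin n → ℝ) i => alphaFun α (η i)) θ Z =
      fun k => deriv (alphaFun α) (θ k) * Z k :=
    (hasDerivAt_pi.2 fun k => HasDerivAt.comp (h₂ := alphaFun α) 0
      (by simpa using (hθ k).hasDerivAt)
      (hasDerivAt_linearMap_line (LinearMap.proj k) θ Z)).deriv
  rw [dirDeriv_mapCoords hθ, dirDeriv_mapCoords hθ, gAlpha, pullbackMetric, coordinatewise,
    coordinatewise, EuclideanSpace.inner_toLp_toLp, dotProduct_comm]
  rfl

theorem scalarCurvature_gAlpha (hθ : θ ∈ probSpace n) {d : ℕ}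
    (b : Module.Basis (Fin d) ℝ (probTangent n)) {c : ℝ} (hc : c = √(∑ k, θ k ^ (α + 1))) :
    scalarCurvature b (gAlpha α) θ =
      (1 + α) ^ 2 / (4 * c ^ 2) * ∑ t, ∑ s ∈ Finset.univ.erase t,
        θ t ^ α * θ s ^ α * (1 - (θ t ^ (α + 1) + θ s ^ (α + 1)) / c ^ 2) := by
  have := neZero_of_mem_probSpace hθ
  have hf' (k : Fin n) : deriv (alphaFun α) (θ k) ≠ 0 := by
    rw [deriv_alphaFun α (hθ.1 k)]
    exact (Real.rpow_pos_of_pos (hθ.1 k) _).ne'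
  rw [← cNorm_alphaFun α hθ.1] at hc
  have hc0 : c ≠ 0 := hc ▸ cNorm_ne_zero hf'
  have hco : Set.BijOn (euclideanCoords n) (probTangent n) {w | ∑ k, w k = 0} :=
    ⟨fun _ h => h, euclideanCoords_bijective.1.injOn, fun w hw => ⟨w.ofLp, hw, rfl⟩⟩
  rw [scalarCurvature_pullback_mapCoords (g := gAlpha α) (p := θ) (b := b) hco
    (fun k => contDiffAt_alphaFun α (hθ.1 k)) hf'
    fun q _ hq X _ Y _ => gAlpha_eq_inner_dirDeriv_mapCoords α hq X Y, ofLp_euclideanCoords,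
    diagDoubleSum_alphaFun α hθ.1, ← hc]
  simp only [Finset.mul_sum]
  refine Finset.sum_congr rfl fun t _ => Finset.sum_congr rfl fun s _ => ?_
  field_simp
  ring

end Alpha

section ParametricIntegral

open Set MeasureTheory

variable {P E : Type*} [NormedAddCommGroup P] [NormedSpace ℝ P] [NormedAddCommGroup E] {m : ℕ∞}
  {O : Set P}

theorem contDiffOn_setIntegral [NormedSpace ℝ E] {G : Type*} [NormedAddCommGroup G]
    [NormedSpace ℝ G] [FiniteDimensional ℝ G] [MeasurableSpace G] [BorelSpace G] {μ : Measure G}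
    [IsFiniteMeasureOnCompacts μ] {K : Set G} (hK : Bornology.IsBounded K)
    (hKm : MeasurableSet K) (hO : IsOpen O) {Ψ : P → G → E}
    (hΨ : ContDiffOn ℝ m (fun q : P × G => Ψ q.1 q.2) (O ×ˢ univ)) :
    ContDiffOn ℝ m (fun x => ∫ t in K, Ψ x t ∂μ) O := by
  obtain ⟨r, hr, hKr⟩ := hK.subset_closedBall_lt 0 (0 : G)
  let χ : ContDiffBump (0 : G) := ⟨r, r + 1, hr, lt_add_one r⟩
  -- The integral is the convolution at `0` of the indicator of `K` with a cut-off of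
  -- `t ↦ Ψ x (-t)`.
  have cutoff : ContDiffOn ℝ m (fun q : P × G => χ q.2 • Ψ q.1 (-q.2)) (O ×ˢ univ) :=
    (χ.contDiff.comp contDiff_snd).contDiffOn.smul
      (hΨ.comp (contDiff_fst.prodMk contDiff_snd.neg).contDiffOn fun q hq => ⟨hq.1, mem_univ _⟩)
  have indicator : LocallyIntegrable (K.indicator fun _ => (1 : ℝ)) μ :=
    ((integrable_indicator_iff hKm).2
      (integrableOn_const (hK.measure_lt_top.ne))).locallyIntegrable
  refine (contDiffOn_convolution_right_with_param_comp (ContinuousLinearMap.lsmul ℝ ℝ)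
    (contDiffOn_const (c := (0 : G))) hO (isCompact_closedBall (0 : G) (r + 1))
    (g := fun x t => χ t • Ψ x (-t)) ?_ indicator cutoff).congr fun x _ => ?_
  · intro x t _ ht
    have : χ t = 0 := χ.zero_of_le_dist (not_le.1 ht).le
    rw [this, zero_smul]
  · rw [convolution_def, ← integral_indicator hKm]
    refine integral_congr_ae (.of_forall fun t => ?_)
    by_cases ht : t ∈ K
    · have : χ (-t) = 1 := χ.one_of_mem_closedBall (by simpa using hKr ht)
      simp [ht, this]
    · simp [ht]

theorem contDiffOn_circleIntegral [NormedSpace ℂ E] (hO : IsOpen O)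
    {Ψ : P → ℂ → E} {c : ℂ} {R : ℝ}
    (hΨ : ContDiffOn ℝ m (fun q : P × ℝ => Ψ q.1 (circleMap c R q.2)) (O ×ˢ univ)) :
    ContDiffOn ℝ m (fun x => ∮ z in C(c, R), Ψ x z) O := by
  simp only [circleIntegral, intervalIntegral.integral_of_le Real.two_pi_pos.le]
  refine contDiffOn_setIntegral (Metric.isBounded_Ioc _ _) measurableSet_Ioc hO
    (ContDiffOn.smul ?_ hΨ)
  simp only [deriv_circleMap]
  exact ((contDiff_circleMap 0 R).comp contDiff_snd).contDiffOn.mul contDiffOn_const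

end ParametricIntegral

section RealAnalytic

theorem exists_analyticAt_complex_extension {f : ℝ → ℝ} {c : ℝ} (hf : AnalyticAt ℝ f c) :
    ∃ F : ℂ → ℂ, AnalyticAt ℂ F c ∧ ∀ᶠ t : ℝ in 𝓝 c, F t = f t := by
  obtain ⟨p, r, hp⟩ := hf
  let q : FormalMultilinearSeries ℂ ℂ ℂ := .ofScalars ℂ fun k => (p.coeff k : ℂ)
  have norm_eq (k : ℕ) : ‖q k‖ = ‖p k‖ := by simp [q]
  have radius_le : p.radius ≤ q.radius := by
    refine ENNReal.le_of_forall_nnreal_lt fun s hs => q.le_radius_of_summable ?_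
    simpa only [norm_eq] using p.summable_norm_mul_pow hs
  refine ⟨fun z => q.sum (z - c), ?_, ?_⟩
  · have := (q.hasFPowerSeriesOnBall (hp.r_pos.trans_le (hp.r_le.trans radius_le))).analyticAt
    exact AnalyticAt.fun_comp (g := q.sum) (by simpa using this) (by fun_prop)
  · filter_upwards [hasFPowerSeriesAt_iff'.1 hp.hasFPowerSeriesAt] with t ht
    have := Complex.hasSum_ofReal.2 ht
    simp only [FormalMultilinearSeries.sum]
    rw [← this.tsum_eq]
    simp [q]

theorem analyticAt_dslope {f : ℝ → ℝ} {c x : ℝ} (hc : AnalyticAt ℝ f c) (hx : AnalyticAt ℝ f x) :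
    AnalyticAt ℝ (dslope f c) x := by
  by_cases h : x = c
  · obtain ⟨p, hp⟩ := hc
    exact h ▸ hp.has_fpower_series_dslope_fslope.analyticAt
  · have : dslope f c =ᶠ[𝓝 x] slope f c := by
      filter_upwards [isOpen_ne.mem_nhds h] with t ht using dslope_of_ne f ht
    refine AnalyticAt.congr ?_ this.symm
    simp only [slope_fun_def_field]
    exact (hx.sub analyticAt_const).div (analyticAt_id.sub analyticAt_const) (sub_ne_zero.2 h)

end RealAnalytic

section RieszDunford

open Set Metric MeasureTheory

variable {𝒜 : Type*} [CStarAlgebra 𝒜]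

theorem cfc_sub_inv {a : 𝒜} (ha : IsStarNormal a) {z : ℂ} (hz : z ∉ spectrum ℂ a) :
    cfc (fun w => (z - w)⁻¹) a = Ring.inverse (algebraMap ℂ 𝒜 z - a) := by
  rw [cfc_inv (fun w => z - w) a fun w hw => sub_ne_zero.2 fun h => hz (h ▸ hw),
    cfc_sub (fun _ => z) (fun w => w) a, cfc_const z a, cfc_id' ℂ a]

theorem cfc_circleIntegral_sub_inv_smul {a : 𝒜} (ha : IsStarNormal a) {F : ℂ → ℂ} {c : ℂ} {R : ℝ}
    (hR : 0 ≤ R) (hF : ContinuousOn F (sphere c R))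
    (hsphere : Disjoint (sphere c R) (spectrum ℂ a)) :
    cfc (fun w => ∮ z in C(c, R), (z - w)⁻¹ • F z) a =
      ∮ z in C(c, R), F z • Ring.inverse (algebraMap ℂ 𝒜 z - a) := by
  have kernel : ContinuousOn (fun q : ℂ × ℂ => (q.1 - q.2)⁻¹ • F q.1)
      (sphere c R ×ˢ spectrum ℂ a) := by
    refine ContinuousOn.smul (ContinuousOn.inv₀ (continuousOn_fst.sub continuousOn_snd) fun q hq =>
      sub_ne_zero.2 (hsphere.ne_of_mem hq.1 hq.2)) (hF.comp continuousOn_fst fun q hq => hq.1)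
  have compact : IsCompact (sphere c R ×ˢ spectrum ℂ a) :=
    (isCompact_sphere c R).prod (spectrum.isCompact a)
  obtain ⟨C, hC⟩ := compact.exists_bound_of_continuousOn kernel
  simp only [circleIntegral, intervalIntegral.integral_of_le Real.two_pi_pos.le]
  have onCircle (θ : ℝ) := circleMap_mem_sphere c hR θ
  rw [cfc_integral (fun θ w => deriv (circleMap c R) θ •
    ((circleMap c R θ - w)⁻¹ • F (circleMap c R θ))) (fun _ => R * C) a ?_ ?_ ?_ ha]
  · refine integral_congr_ae (.of_forall fun θ => ?_)
    have hz : circleMap c R θ ∉ spectrum ℂ a := hsphere.notMem_of_mem_left (onCircle θ)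
    have continuous_inv : ContinuousOn (fun w => (circleMap c R θ - w)⁻¹) (spectrum ℂ a) :=
      (continuousOn_const.sub continuousOn_id).inv₀ fun w hw =>
        sub_ne_zero.2 (ne_of_mem_of_not_mem hw hz).symm
    simp only [smul_eq_mul, mul_comm _⁻¹, ← mul_assoc]
    rw [cfc_const_mul _ _ a continuous_inv, cfc_sub_inv ha hz, mul_smul]
  · have onCircles : ContinuousOn (fun q : ℝ × ℂ => (circleMap c R q.1 - q.2)⁻¹ •
        F (circleMap c R q.1)) (univ ×ˢ spectrum ℂ a) :=
      kernel.comp (f := fun q : ℝ × ℂ => (circleMap c R q.1, q.2)) (by fun_prop)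
        fun q hq => ⟨onCircle q.1, hq.2⟩
    simp only [deriv_circleMap]
    exact ContinuousOn.smul (f := fun q : ℝ × ℂ => circleMap 0 R q.1 * Complex.I) (by fun_prop)
      onCircles
  · refine .of_forall fun θ w hw => ?_
    rw [norm_smul, deriv_circleMap, norm_mul, norm_circleMap_zero, abs_of_nonneg hR,
      Complex.norm_I, mul_one]
    exact mul_le_mul_of_nonneg_left (hC (circleMap c R θ, w) ⟨onCircle θ, hw⟩) hR
  · exact hasFiniteIntegral_const _

theorem circleIntegral_sub_inv_smul_eq_zero {F : ℂ → ℂ} {c w : ℂ} {R : ℝ}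
    (hR : 0 ≤ R) (hF : DifferentiableOn ℂ F (closedBall c R)) (hw : w ∉ closedBall c R) :
    (∮ z in C(c, R), (z - w)⁻¹ • F z) = 0 := by
  refine DiffContOnCl.circleIntegral_eq_zero hR (DifferentiableOn.diffContOnCl_ball
    (U := closedBall c R) ?_ subset_rfl)
  exact DifferentiableOn.smul (DifferentiableOn.inv (by fun_prop) fun z hz =>
    sub_ne_zero.2 (ne_of_mem_of_not_mem hz hw)) hF

theorem isOpen_setOf_disjoint_spectrum {K : Set ℂ} (hK : IsClosed K) :
    IsOpen {a : 𝒜 | Disjoint K (spectrum ℂ a)} := by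
  simp only [disjoint_comm (a := K), ← Set.subset_compl_iff_disjoint_right]
  exact isOpen_iff_mem_nhds.2 fun a =>
    (upperHemicontinuous_spectrum ℂ 𝒜).forall_isOpen a _ hK.isOpen_compl

theorem contDiffOn_circleIntegral_smul_inverse {F : ℂ → ℂ} {c : ℂ} {R : ℝ} {m : ℕ∞} (hR : 0 ≤ R)
    (hF : AnalyticOnNhd ℂ F (sphere c R)) :
    ContDiffOn ℝ m (fun a : 𝒜 => ∮ z in C(c, R), F z • Ring.inverse (algebraMap ℂ 𝒜 z - a))
      {a | Disjoint (sphere c R) (spectrum ℂ a)} := by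
  refine contDiffOn_circleIntegral (isOpen_setOf_disjoint_spectrum isClosed_sphere) ?_
  rintro ⟨a, θ⟩ ⟨ha, -⟩
  have onCircle : circleMap c R θ ∈ sphere c R := circleMap_mem_sphere c hR θ
  have circle : ContDiffAt ℝ m (fun q : 𝒜 × ℝ => circleMap c R q.2) (a, θ) :=
    ((contDiff_circleMap c R).comp contDiff_snd).contDiffAt
  obtain ⟨v, hv⟩ := spectrum.notMem_iff.1 (ha.notMem_of_mem_left onCircle)
  have resolvent : ContDiffAt ℝ m Ring.inverse (algebraMap ℂ 𝒜 (circleMap c R θ) - a) :=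
    hv ▸ contDiffAt_ringInverse ℝ v
  have outer : ContDiffAt ℝ m (fun q : 𝒜 × ℝ => F (circleMap c R q.2)) (a, θ) :=
    ContDiffAt.comp (g := F) (a, θ) ((hF _ onCircle).contDiffAt.restrict_scalars ℝ) circle
  refine (outer.smul ?_).contDiffWithinAt
  exact ContDiffAt.comp (a, θ) resolvent
    ((((algebraMapCLM ℂ 𝒜).restrictScalars ℝ).contDiff.contDiffAt.comp (a, θ) circle).sub
      contDiffAt_fst)

theorem continuousOn_circleIntegral_sub_inv_smul {F : ℂ → ℂ} {c : ℂ} {R : ℝ} (hR : 0 ≤ R)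
    (hF : AnalyticOnNhd ℂ F (sphere c R)) :
    ContinuousOn (fun w => ∮ z in C(c, R), (z - w)⁻¹ • F z) (sphere c R)ᶜ := by
  have := (contDiffOn_circleIntegral_smul_inverse (𝒜 := ℂ) (m := 0) hR hF).continuousOn
  have spectrum_eq (w : ℂ) : spectrum ℂ w = {w} := spectrum.scalar_eq w
  simpa only [spectrum_eq, disjoint_singleton_right, ← mem_compl_iff,
    ofPred_mem_eq, Algebra.algebraMap_self, RingHom.id_apply, Ring.inverse_eq_inv', smul_eq_mul,
    mul_comm (F _)] using this

/-- Holomorphic extensions of a real function `f` to disjoint discs of a common radius around the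
points of a finite set `S`. For a self-adjoint element with spectrum close to `S`, Cauchy's formula
on the boundary circles expresses the functional calculus at `f` through the resolvent. -/
structure RieszContour (f : ℝ → ℝ) (S : Finset ℝ) where
  /-- The common radius. -/
  r : ℝ
  r_pos : 0 < r
  /-- The holomorphic extension of `f` near a point of `S`. -/
  F : ℝ → ℂ → ℂ
  analyticOnNhd : ∀ c ∈ S, AnalyticOnNhd ℂ (F c) (closedBall c r)
  eq_ofReal : ∀ c ∈ S, ∀ t ∈ ball c r, F c t = f t
  separated : ∀ c ∈ S, ∀ c' ∈ S, c ≠ c' → 2 * r < dist c c'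

namespace RieszContour

variable {f : ℝ → ℝ} {S : Finset ℝ}

theorem nonempty (hf : ∀ c ∈ S, AnalyticAt ℝ f c) : Nonempty (RieszContour f S) := by
  have extension (c : ℝ) : ∃ F : ℂ → ℂ, c ∈ S →
      AnalyticAt ℂ F c ∧ ∀ᶠ t : ℝ in 𝓝 c, F t = f t := by
    by_cases hc : c ∈ S
    · exact (exists_analyticAt_complex_extension (hf c hc)).imp fun _ h _ => h
    · exact ⟨0, fun h => absurd h hc⟩
  choose F hF using extension
  have small {r : ℝ} (hr : 0 < r) : ∀ᶠ ε in 𝓝[>] (0 : ℝ), ε < r :=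
    (gt_mem_nhds hr).filter_mono nhdsWithin_le_nhds
  have analytic : ∀ᶠ ε in 𝓝[>] (0 : ℝ), ∀ c ∈ S, AnalyticOnNhd ℂ (F c) (closedBall c ε) :=
    (Finset.eventually_all S).2 fun c hc => by
      obtain ⟨r, hr, h⟩ := nhds_basis_closedBall.mem_iff.1 (hF c hc).1.eventually_analyticAt
      exact (small hr).mono fun ε hε z hz => h (closedBall_subset_closedBall hε.le hz)
  have extends_f : ∀ᶠ ε in 𝓝[>] (0 : ℝ), ∀ c ∈ S, ∀ t ∈ ball c ε, F c t = f t :=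
    (Finset.eventually_all S).2 fun c hc => by
      obtain ⟨r, hr, h⟩ := nhds_basis_ball.mem_iff.1 (hF c hc).2
      exact (small hr).mono fun ε hε t ht => h (ball_subset_ball hε.le ht)
  have separated : ∀ᶠ ε in 𝓝[>] (0 : ℝ), ∀ c ∈ S, ∀ c' ∈ S, c ≠ c' → 2 * ε < dist c c' :=
    (Finset.eventually_all S).2 fun c _ => (Finset.eventually_all S).2 fun c' _ => by
      rcases eq_or_ne c c' with h | h
      · simp [h]
      · exact (small (half_pos (dist_pos.2 h))).mono fun ε hε _ => by linarith
  obtain ⟨ε, ⟨⟨hanalytic, hextends⟩, hseparated⟩, hε⟩ :=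
    (((analytic.and extends_f).and separated).and self_mem_nhdsWithin).exists
  exact ⟨ε, hε, F, hanalytic, hextends, hseparated⟩

/-- The sum of the Cauchy integrals `(2πi)⁻¹ ∮ F(z) (z - a)⁻¹ dz` over the circles of a contour. -/
def calculus (Γ : RieszContour f S) (a : 𝒜) : 𝒜 :=
  ∑ c ∈ S, (2 * Real.pi * Complex.I : ℂ)⁻¹ •
    ∮ z in C((c : ℂ), Γ.r), Γ.F c z • Ring.inverse (algebraMap ℂ 𝒜 z - a)

variable (Γ : RieszContour f S)

theorem dist_le_iff_eq {c c' t : ℝ} (hc : c ∈ S) (hc' : c' ∈ S) (ht : t ∈ ball c Γ.r) :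
    dist t c' ≤ Γ.r ↔ c' = c := by
  refine ⟨fun h => ?_, fun h => h ▸ (mem_ball.1 ht).le⟩
  by_contra hne
  have := Γ.separated c' hc' c hc hne
  have := dist_triangle_left c' c t
  have := mem_ball.1 ht
  linarith

theorem sum_circleIntegral_eq {c t : ℝ} (hc : c ∈ S) (ht : t ∈ ball c Γ.r) :
    ∑ c' ∈ S, (2 * Real.pi * Complex.I : ℂ)⁻¹ *
      ∮ z in C((c' : ℂ), Γ.r), (z - t)⁻¹ • Γ.F c' z = f t := by
  rw [Finset.sum_eq_single_of_mem c hc fun c' hc' hne => ?_, ← Γ.eq_ofReal c hc t ht]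
  · refine DiffContOnCl.two_pi_i_inv_smul_circleIntegral_sub_inv_smul
      ((Γ.analyticOnNhd c hc).differentiableOn.diffContOnCl_ball subset_rfl) ?_
    rwa [mem_ball, Complex.isometry_ofReal.dist_eq]
  · rw [circleIntegral_sub_inv_smul_eq_zero Γ.r_pos.le (Γ.analyticOnNhd c' hc').differentiableOn,
      mul_zero]
    rwa [mem_closedBall, Complex.isometry_ofReal.dist_eq, Γ.dist_le_iff_eq hc hc' ht]

theorem disjoint_sphere {a : 𝒜} (ha : IsSelfAdjoint a)
    (hspec : spectrum ℝ a ⊆ ⋃ c ∈ S, ball c Γ.r) {c : ℝ} (hc : c ∈ S) :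
    Disjoint (sphere (c : ℂ) Γ.r) (spectrum ℂ a) := by
  rw [← ha.spectrumRestricts.algebraMap_image, disjoint_right]
  rintro _ ⟨t, ht, rfl⟩ hsphere
  obtain ⟨c', hc', htc'⟩ := mem_iUnion₂.1 (hspec ht)
  have on_sphere : dist t c = Γ.r := (Complex.isometry_ofReal.dist_eq t c).symm.trans hsphere
  obtain rfl := (Γ.dist_le_iff_eq hc' hc htc').1 on_sphere.le
  exact htc'.ne on_sphere

theorem cfc_eq {a : 𝒜} (ha : IsSelfAdjoint a) (hspec : spectrum ℝ a ⊆ ⋃ c ∈ S, ball c Γ.r) :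
    cfc f a = Γ.calculus a := by
  have analytic (c : ℝ) (hc : c ∈ S) : AnalyticOnNhd ℂ (Γ.F c) (sphere c Γ.r) :=
    (Γ.analyticOnNhd c hc).mono sphere_subset_closedBall
  have disjoint (c : ℝ) (hc : c ∈ S) := Γ.disjoint_sphere ha hspec hc
  have continuous (c : ℝ) (hc : c ∈ S) : ContinuousOn
      (fun w => ∮ z in C((c : ℂ), Γ.r), (z - w)⁻¹ • Γ.F c z) (spectrum ℂ a) :=
    (continuousOn_circleIntegral_sub_inv_smul Γ.r_pos.le (analytic c hc)).mono
      (disjoint c hc).subset_compl_left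
  have cauchy : (spectrum ℂ a).EqOn (fun w => (f w.re : ℂ))
      (∑ c ∈ S, fun w =>
        (2 * Real.pi * Complex.I : ℂ)⁻¹ * ∮ z in C((c : ℂ), Γ.r), (z - w)⁻¹ • Γ.F c z) := by
    rw [← ha.spectrumRestricts.algebraMap_image]
    rintro _ ⟨t, ht, rfl⟩
    obtain ⟨c, hc, htc⟩ := mem_iUnion₂.1 (hspec ht)
    rw [Finset.sum_apply]
    exact (Γ.sum_circleIntegral_eq hc htc).symm
  rw [cfc_real_eq_complex f ha, cfc_congr cauchy,
    cfc_sum _ a S fun c hc => continuousOn_const.fun_mul (continuous c hc)]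
  refine Finset.sum_congr rfl fun c hc => ?_
  rw [cfc_const_mul _ _ a (continuous c hc), cfc_circleIntegral_sub_inv_smul ha.isStarNormal
    Γ.r_pos.le (analytic c hc).continuousOn (disjoint c hc)]

theorem contDiffAt_calculus {m : ℕ∞} {a : 𝒜} (ha : IsSelfAdjoint a)
    (hspec : spectrum ℝ a ⊆ ⋃ c ∈ S, ball c Γ.r) :
    ContDiffAt ℝ m (fun a : 𝒜 => Γ.calculus a) a :=
  ContDiffAt.sum fun c hc => ContDiffAt.const_smul _ <|
    (contDiffOn_circleIntegral_smul_inverse Γ.r_pos.le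
      ((Γ.analyticOnNhd c hc).mono sphere_subset_closedBall)).contDiffAt
      ((isOpen_setOf_disjoint_spectrum isClosed_sphere).mem_nhds (Γ.disjoint_sphere ha hspec hc))

end RieszContour

theorem contDiffAt_cfc {X : Type*} [NormedAddCommGroup X] [NormedSpace ℝ X] {A : X → 𝒜} {x₀ : X}
    {f : ℝ → ℝ} {m : ℕ∞} (hA : ContDiffAt ℝ m A x₀) (hsa : ∀ x, IsSelfAdjoint (A x))
    (hfin : (spectrum ℝ (A x₀)).Finite) (hf : ∀ c ∈ spectrum ℝ (A x₀), AnalyticAt ℝ f c) :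
    ContDiffAt ℝ m (fun x => cfc f (A x)) x₀ := by
  obtain ⟨Γ⟩ := RieszContour.nonempty (S := hfin.toFinset) (by simpa using hf)
  have hV : IsOpen (⋃ c ∈ hfin.toFinset, ball c Γ.r) := isOpen_biUnion fun _ _ => isOpen_ball
  have hspec : spectrum ℝ (A x₀) ⊆ ⋃ c ∈ hfin.toFinset, ball c Γ.r := fun c hc =>
    mem_biUnion (hfin.mem_toFinset.2 hc) (mem_ball_self Γ.r_pos)
  refine ((Γ.contDiffAt_calculus (hsa x₀) hspec).comp x₀ hA).congr_of_eventuallyEq ?_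
  filter_upwards [hA.continuousAt.eventually
    ((upperHemicontinuous_spectrum ℝ 𝒜).forall_isOpen _ _ hV hspec)] with x hx
    using Γ.cfc_eq (hsa x) hx

end RieszDunford

section MatrixCalculus

open scoped Matrix.Norms.Operator

variable {𝕜 ι : Type*} [RCLike 𝕜] [Fintype ι] [DecidableEq ι]

variable (𝕜) in
/-- The inclusion of `𝕜`, which is `ℝ` or `ℂ`, into `ℂ`. -/
def rclikeToComplex : 𝕜 →ₐ[ℝ] ℂ :=
  AlgHom.ofLinearMap (RCLike.map 𝕜 ℂ).toLinearMap (by simp) fun x y => by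
    apply Complex.ext <;> simp [RCLike.map_apply]

variable (𝕜 ι) in
/-- The inclusion of the matrices over `𝕜` into the complex matrices, which form a C⋆-algebra. -/
def matrixToComplex : Matrix ι ι 𝕜 →⋆ₐ[ℝ] Matrix ι ι ℂ where
  toAlgHom := (rclikeToComplex 𝕜).mapMatrix
  map_star' A := by
    ext i j
    apply Complex.ext <;> simp [rclikeToComplex, RCLike.map_apply, Matrix.star_apply]

theorem matrixToComplex_injective : Function.Injective (matrixToComplex 𝕜 ι) :=
  Matrix.map_injective (rclikeToComplex 𝕜).toRingHom.injective

theorem contDiffAt_matrix_cfc_of_injective {ℬ X : Type*} [CStarAlgebra ℬ] [FiniteDimensional ℝ ℬ]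
    [NormedAddCommGroup X] [NormedSpace ℝ X] {φ : Matrix ι ι 𝕜 →⋆ₐ[ℝ] ℬ}
    (hφ : Function.Injective φ) {A : X → Matrix ι ι 𝕜} {x₀ : X} {f : ℝ → ℝ} {m : ℕ∞}
    (hA : ContDiffAt ℝ m A x₀) (hH : ∀ x, (A x).IsHermitian)
    (hf : ∀ i, AnalyticAt ℝ f ((hH x₀).eigenvalues i)) :
    ContDiffAt ℝ m (fun x => cfc f (A x)) x₀ := by
  let L : Matrix ι ι 𝕜 →L[ℝ] ℬ := φ.toAlgHom.toLinearMap.toContinuousLinearMap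
  obtain ⟨R, hR⟩ := ContinuousLinearMap.HasLeftInverse.of_injective_of_finiteDimensional (f := L) hφ
  have hsa : ∀ x, IsSelfAdjoint (φ (A x)) := fun x => IsSelfAdjoint.map (x := A x) (hH x) φ
  have hcfc : (fun x => cfc f (A x)) = fun x => R (cfc f (φ (A x))) := by
    funext x
    have hmap : φ (cfc f (A x)) = cfc f (φ (A x)) := StarAlgHom.map_cfc (S := ℝ) φ f (A x)
      ((A x).finite_real_spectrum.continuousOn f) L.continuous (hH x) (hsa x)
    rw [← hmap]
    exact (hR _).symm
  have hspec : spectrum ℝ (φ (A x₀)) ⊆ spectrum ℝ (A x₀) :=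
    AlgHom.spectrum_apply_subset φ (A x₀)
  rw [hcfc]
  refine R.contDiff.contDiffAt.comp x₀ (contDiffAt_cfc (L.contDiff.contDiffAt.comp x₀ hA) hsa
    (Matrix.finite_real_spectrum.subset hspec) fun c hc => ?_)
  obtain ⟨i, rfl⟩ := (hH x₀).spectrum_real_eq_range_eigenvalues ▸ hspec hc
  exact hf i

theorem contDiffAt_matrix_cfc {X : Type*} [NormedAddCommGroup X] [NormedSpace ℝ X]
    {A : X → Matrix ι ι 𝕜} {x₀ : X} {f : ℝ → ℝ} {m : ℕ∞} (hA : ContDiffAt ℝ m A x₀)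
    (hH : ∀ x, (A x).IsHermitian) (hf : ∀ i, AnalyticAt ℝ f ((hH x₀).eigenvalues i)) :
    ContDiffAt ℝ m (fun x => cfc f (A x)) x₀ :=
  let _ : CStarAlgebra (Matrix ι ι ℂ) := Matrix.instCStarAlgebra
  contDiffAt_matrix_cfc_of_injective (φ := matrixToComplex 𝕜 ι) matrixToComplex_injective hA hH hf

theorem eventually_forall_eigenvalues_mem {D : Matrix ι ι 𝕜} (hD : D.IsHermitian) {V : Set ℝ}
    (hV : IsOpen V) (h : ∀ i, hD.eigenvalues i ∈ V) :
    ∀ᶠ A in 𝓝 D, ∀ hA : A.IsHermitian, ∀ i, hA.eigenvalues i ∈ V := by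
  have hsub : spectrum ℝ D ⊆ V := by
    rw [hD.spectrum_real_eq_range_eigenvalues]
    exact Set.range_subset_iff.2 h
  filter_upwards [(upperHemicontinuous_spectrum ℝ _).forall_isOpen D V hV hsub] with A hA hAH i
  exact hA (hAH.eigenvalues_mem_spectrum_real i)

omit [Fintype ι] [DecidableEq ι] in
theorem isHermitian_add_smul {D X : Matrix ι ι 𝕜} (hD : D.IsHermitian) (hX : X.IsHermitian)
    (t : ℝ) : (D + t • X).IsHermitian :=
  hD.add (IsSelfAdjoint.smul (IsSelfAdjoint.all t) hX)

theorem hasDerivAt_cfc_line {f : ℝ → ℝ} {D X : Matrix ι ι 𝕜} (hD : D.IsHermitian)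
    (hf : ∀ i, AnalyticAt ℝ f (hD.eigenvalues i)) (hX : X.IsHermitian) :
    HasDerivAt (fun t : ℝ => cfc f (D + t • X)) (dirDeriv (fun A => cfc f A) D X) 0 := by
  have h : ContDiffAt ℝ (1 : ℕ∞) (fun t : ℝ => cfc f (D + t • X)) 0 :=
    contDiffAt_matrix_cfc (by fun_prop) (isHermitian_add_smul hD hX) (by simpa using hf)
  exact (h.differentiableAt (by simp)).hasDerivAt

/-- The change of basis to the eigenbasis of the Hermitian matrix `D`. -/
def inEigenbasis {D : Matrix ι ι 𝕜} (hD : D.IsHermitian) : Matrix ι ι 𝕜 ≃⋆ₐ[ℝ] Matrix ι ι 𝕜 :=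
  Unitary.conjStarAlgAut ℝ _ (star hD.eigenvectorUnitary)

theorem inEigenbasis_cfc {D : Matrix ι ι 𝕜} (hD : D.IsHermitian) (f : ℝ → ℝ) :
    inEigenbasis hD (cfc f D) = Matrix.diagonal fun i => (f (hD.eigenvalues i) : 𝕜) := by
  rw [hD.cfc_eq]
  change inEigenbasis hD (Unitary.conjStarAlgAut ℝ _ hD.eigenvectorUnitary _) = _
  rw [inEigenbasis, ← Unitary.conjStarAlgAut_symm, StarAlgEquiv.symm_apply_apply]
  rfl

theorem trace_inEigenbasis {D : Matrix ι ι 𝕜} (hD : D.IsHermitian) (A : Matrix ι ι 𝕜) :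
    (inEigenbasis hD A).trace = A.trace := by
  rw [inEigenbasis, Unitary.conjStarAlgAut_star_apply, Matrix.mul_assoc, Matrix.trace_mul_comm,
    Matrix.mul_assoc, Unitary.mul_star_self_of_mem hD.eigenvectorUnitary.2, Matrix.mul_one]

theorem isHermitian_inEigenbasis_iff {D A : Matrix ι ι 𝕜} (hD : D.IsHermitian) :
    (inEigenbasis hD A).IsHermitian ↔ A.IsHermitian := by
  rw [Matrix.IsHermitian, Matrix.IsHermitian, ← Matrix.star_eq_conjTranspose,
    ← Matrix.star_eq_conjTranspose, ← map_star, EmbeddingLike.apply_eq_iff_eq]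

theorem cfc_eq_add_mul_cfc_dslope {A : Matrix ι ι 𝕜} (hA : A.IsHermitian) (f : ℝ → ℝ) (c : ℝ) :
    cfc f A = algebraMap ℝ _ (f c) + (A - algebraMap ℝ _ c) * cfc (dslope f c) A := by
  have hA' : IsSelfAdjoint A := hA
  have hcont : ∀ h : ℝ → ℝ, ContinuousOn h (spectrum ℝ A) := A.finite_real_spectrum.continuousOn
  have hf : f = fun x => f c + (x - c) * dslope f c x := by
    funext x
    rw [← smul_eq_mul, sub_smul_dslope, add_sub_cancel]
  conv_lhs => rw [hf]
  rw [cfc_const_add (f c) _ A (hcont _), cfc_mul _ _ A (hcont _) (hcont _),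
    cfc_sub (fun x => x) (fun _ => c) A (hcont _) (hcont _), cfc_id' ℝ A, cfc_const c A]

/-- With `c = λᵢ`, row `i` of `D - c` vanishes in the eigenbasis, which leaves a multiple of `t`. -/
theorem inEigenbasis_cfc_line_apply {D X : Matrix ι ι 𝕜} (hD : D.IsHermitian) (hX : X.IsHermitian)
    (f : ℝ → ℝ) (t : ℝ) (i j : ι) :
    inEigenbasis hD (cfc f (D + t • X)) i j
      = algebraMap ℝ (Matrix ι ι 𝕜) (f (hD.eigenvalues i)) i j
        + t • inEigenbasis hD (X * cfc (dslope f (hD.eigenvalues i)) (D + t • X)) i j := by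
  have hrow : ∀ W : Matrix ι ι 𝕜,
      inEigenbasis hD ((D - algebraMap ℝ _ (hD.eigenvalues i)) * W) i j = 0 := fun W => by
    have hD' : inEigenbasis hD D = Matrix.diagonal fun k => (hD.eigenvalues k : 𝕜) := by
      have hsa : IsSelfAdjoint D := hD
      simpa only [cfc_id' ℝ D] using inEigenbasis_cfc hD fun x => x
    rw [map_mul, map_sub, hD', AlgHomClass.commutes, Matrix.algebraMap_eq_diagonal,
      Matrix.diagonal_sub, Matrix.diagonal_mul]
    simp
  rw [cfc_eq_add_mul_cfc_dslope (isHermitian_add_smul hD hX t) f (hD.eigenvalues i),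
    add_sub_right_comm, add_mul, smul_mul_assoc, map_add, map_add, map_smul, AlgHomClass.commutes,
    Matrix.add_apply, Matrix.add_apply, hrow, zero_add, Matrix.smul_apply]

theorem inEigenbasis_dirDeriv_cfc {f : ℝ → ℝ} {D X : Matrix ι ι 𝕜} (hD : D.IsHermitian)
    (hf : ∀ i, AnalyticAt ℝ f (hD.eigenvalues i)) (hX : X.IsHermitian) (i j : ι) :
    inEigenbasis hD (dirDeriv (fun A => cfc f A) D X) i j
      = dslope f (hD.eigenvalues i) (hD.eigenvalues j) • inEigenbasis hD X i j := by
  let entry := ((Matrix.entryLinearMap ℝ 𝕜 i j).comp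
    (inEigenbasis hD).toAlgEquiv.toLinearMap).toContinuousLinearMap
  have hcont : ContinuousAt (fun t : ℝ => entry
      (X * cfc (dslope f (hD.eigenvalues i)) (D + t • X))) 0 :=
    entry.continuous.continuousAt.comp (continuousAt_const.mul (hasDerivAt_cfc_line hD
      (fun k => analyticAt_dslope (hf i) (hf k)) hX).continuousAt)
  have hzero : entry (X * cfc (dslope f (hD.eigenvalues i)) (D + (0 : ℝ) • X))
      = dslope f (hD.eigenvalues i) (hD.eigenvalues j) • inEigenbasis hD X i j := by
    change inEigenbasis hD _ i j = _
    rw [zero_smul, add_zero, map_mul, inEigenbasis_cfc, Matrix.mul_diagonal,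
      RCLike.real_smul_eq_coe_mul, mul_comm]
  refine (entry.hasFDerivAt.comp_hasDerivAt 0 (hasDerivAt_cfc_line hD hf hX)).unique ?_
  rw [← hzero, hasDerivAt_iff_tendsto_slope]
  refine (hcont.tendsto.mono_left nhdsWithin_le_nhds).congr' ?_
  filter_upwards [self_mem_nhdsWithin] with t ht
  change inEigenbasis hD _ i j = slope (fun t => inEigenbasis hD (cfc f (D + t • X)) i j) 0 t
  rw [slope_def_module, inEigenbasis_cfc_line_apply hD hX f t,
    inEigenbasis_cfc_line_apply hD hX f 0, add_sub_add_left_eq_sub, zero_smul, sub_zero, sub_zero,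
    smul_smul, inv_mul_cancel₀ ht, one_smul]

theorem dslope_comm (f : ℝ → ℝ) (x y : ℝ) : dslope f x y = dslope f y x := by
  rcases eq_or_ne x y with rfl | h
  · rfl
  · rw [dslope_of_ne f h.symm, dslope_of_ne f h, slope_comm]

theorem isHermitian_dirDeriv_cfc {f : ℝ → ℝ} {D X : Matrix ι ι 𝕜} (hD : D.IsHermitian)
    (hf : ∀ i, AnalyticAt ℝ f (hD.eigenvalues i)) (hX : X.IsHermitian) :
    (dirDeriv (fun A => cfc f A) D X).IsHermitian := by
  rw [← isHermitian_inEigenbasis_iff hD]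
  ext i j
  rw [Matrix.conjTranspose_apply, inEigenbasis_dirDeriv_cfc hD hf hX,
    inEigenbasis_dirDeriv_cfc hD hf hX, star_smul, star_trivial,
    ((isHermitian_inEigenbasis_iff hD).2 hX).apply, dslope_comm]

end MatrixCalculus

section HermitianCoordinates

variable {𝕜 κ : Type} [RCLike 𝕜] {n : ℕ}

/-- The real coordinates of the entries above the diagonal of an `n × n` matrix, where `κ` indexes
the real coordinates of the field. -/
abbrev OffDiag (n : ℕ) (κ : Type) : Type := (Σ i : Fin n, Finset.Ioi i) × κ

theorem sum_offDiag [Fintype κ] (F : Fin n → Fin n → ℝ) :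
    ∑ a : OffDiag n κ, F a.1.1 a.1.2 = Fintype.card κ * ∑ i, ∑ j ∈ Finset.Ioi i, F i j := by
  rw [Fintype.sum_prod_type, Fintype.sum_sigma]
  simp only [Finset.sum_const, Finset.card_univ, nsmul_eq_mul, ← Finset.mul_sum]
  exact congrArg _ (Finset.sum_congr rfl fun i _ => Finset.sum_coe_sort (Finset.Ioi i) (F i))

/-- The matrix position of a coordinate of a Hermitian matrix. -/
def coordPosition : Fin n ⊕ OffDiag n κ → Fin n × Fin n :=
  Sum.elim (fun i => (i, i)) fun a => (a.1.1, a.1.2)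

variable [Fintype κ]

theorem re_mul_star_eq_inner (τ : 𝕜 ≃ₗᵢ[ℝ] EuclideanSpace ℝ κ) (x y : 𝕜) :
    RCLike.re (x * star y) = inner ℝ (τ x) (τ y) := by
  have h := re_inner_eq_norm_add_mul_self_sub_norm_sub_mul_self_div_four (𝕜 := 𝕜) y x
  have hτ := re_inner_eq_norm_add_mul_self_sub_norm_sub_mul_self_div_four (𝕜 := ℝ) (τ y) (τ x)
  rw [← map_add, ← map_sub, τ.norm_map, τ.norm_map, ← h, RCLike.re_to_real] at hτ
  rw [real_inner_comm, hτ, RCLike.inner_apply, RCLike.star_def]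

/-- The real coordinates of a Hermitian matrix: its diagonal entries and the entries above the
diagonal. The factor `√2` accounts for the entries below the diagonal and makes these coordinates
orthonormal for the trace metric. -/
def hermCoord (τ : 𝕜 ≃ₗᵢ[ℝ] EuclideanSpace ℝ κ) :
    Matrix (Fin n) (Fin n) 𝕜 →ₗ[ℝ] EuclideanSpace ℝ (Fin n ⊕ OffDiag n κ) where
  toFun A := WithLp.toLp 2 <|
    Sum.elim (fun i => RCLike.re (A i i)) fun a => √2 * τ (A a.1.1 a.1.2) a.2
  map_add' A B := by
    ext (i | a) <;> simp [mul_add]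
  map_smul' r A := by
    ext (i | a) <;> simp [RCLike.smul_re, mul_left_comm]

variable {τ : 𝕜 ≃ₗᵢ[ℝ] EuclideanSpace ℝ κ} {A B : Matrix (Fin n) (Fin n) 𝕜}

theorem hermCoord_inl (i : Fin n) : hermCoord τ A (.inl i) = RCLike.re (A i i) := rfl

theorem hermCoord_inr (a : OffDiag n κ) :
    hermCoord τ A (.inr a) = √2 * τ (A a.1.1 a.1.2) a.2 := rfl

theorem hermCoord_eq_mul_of_apply_eq_smul {s : Fin n → Fin n → ℝ}
    (h : ∀ i j, A i j = s i j • B i j) (a : Fin n ⊕ OffDiag n κ) :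
    hermCoord τ A a = s (coordPosition a).1 (coordPosition a).2 * hermCoord τ B a := by
  rcases a with i | a
  · rw [hermCoord_inl, hermCoord_inl, h, RCLike.smul_re]
    rfl
  · rw [hermCoord_inr, hermCoord_inr, h, map_smul, PiLp.smul_apply, smul_eq_mul, mul_left_comm]
    rfl

theorem traceMetric_eq_sum_re_mul_star (hB : B.IsHermitian) :
    traceMetric A B = ∑ i, ∑ j, RCLike.re (A i j * star (B i j)) := by
  simp only [traceMetric, Matrix.trace, Matrix.diag, Matrix.mul_apply, map_sum, hB.apply]

theorem inner_hermCoord (hA : A.IsHermitian) (hB : B.IsHermitian) :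
    inner ℝ (hermCoord τ A) (hermCoord τ B) = traceMetric A B := by
  let F : Fin n → Fin n → ℝ := fun i j => RCLike.re (A i j * star (B i j))
  have diagonal (i : Fin n) : inner ℝ (RCLike.re (A i i)) (RCLike.re (B i i)) = F i i := by
    have him : RCLike.im (A i i) = 0 := RCLike.conj_eq_iff_im.1 (hA.apply i i)
    simp [F, RCLike.mul_re, him, mul_comm]
  have symmetric (i j : Fin n) : F j i = F i j := by
    simp only [F]
    rw [← hA.apply, ← hB.apply i j, star_star, ← RCLike.conj_re]
    simp
  have above (i j : Fin n) : ∑ k, inner ℝ (√2 * τ (A i j) k) (√2 * τ (B i j) k)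
      = F j i + F i j := by
    simp only [symmetric, F]
    rw [← two_mul, re_mul_star_eq_inner τ, PiLp.inner_apply, Finset.mul_sum]
    refine Finset.sum_congr rfl fun k _ => ?_
    simp only [RCLike.inner_apply, conj_trivial]
    linear_combination τ (A i j) k * τ (B i j) k * Real.mul_self_sqrt zero_le_two
  rw [traceMetric_eq_sum_re_mul_star hB, PiLp.inner_apply, Fintype.sum_sum_type,
    Fintype.sum_prod_type, Fintype.sum_sigma]
  simp only [hermCoord_inl, hermCoord_inr, diagonal, above]
  rw [Finset.sum_congr rfl fun i _ => Finset.sum_coe_sort (Finset.Ioi i) fun j => F j i + F i j,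
    Finset.sum_sum_Ioi_add_eq_sum_sum_off_diag, ← Finset.sum_add_distrib, Finset.sum_comm]
  exact Finset.sum_congr rfl fun i _ => (Fintype.sum_eq_add_sum_compl i fun j => F j i).symm

theorem injOn_hermCoord :
    Set.InjOn (hermCoord τ) {A : Matrix (Fin n) (Fin n) 𝕜 | A.IsHermitian} := by
  intro A (hA : A.IsHermitian) B (hB : B.IsHermitian) h
  have above {i j : Fin n} (hij : i < j) : A i j = B i j := by
    refine τ.injective (PiLp.ext fun k => ?_)
    have := congrArg (· (.inr (⟨i, j, Finset.mem_Ioi.2 hij⟩, k))) h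
    exact mul_left_cancel₀ (Real.sqrt_ne_zero'.2 two_pos) this
  ext i j
  rcases lt_trichotomy i j with hij | rfl | hij
  · exact above hij
  · rw [← hA.coe_re_apply_self, ← hB.coe_re_apply_self]
    exact congrArg _ (congrArg (· (.inl i)) h)
  · rw [← hA.apply, ← hB.apply, above hij]

theorem exists_isHermitian_hermCoord_eq (w : EuclideanSpace ℝ (Fin n ⊕ OffDiag n κ)) :
    ∃ A : Matrix (Fin n) (Fin n) 𝕜, A.IsHermitian ∧ hermCoord τ A = w := by
  let U : Matrix (Fin n) (Fin n) 𝕜 := Matrix.of fun i j => if h : i < j then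
    τ.symm (WithLp.toLp 2 fun k => (√2)⁻¹ * w (.inr (⟨i, j, Finset.mem_Ioi.2 h⟩, k))) else 0
  have hU {i j : Fin n} (h : ¬i < j) : U i j = 0 := dif_neg h
  refine ⟨Matrix.diagonal (fun i => (w (.inl i) : 𝕜)) + (U + U.conjTranspose),
    .add (Matrix.isHermitian_diagonal_of_self_adjoint _ (funext fun i => RCLike.conj_ofReal _))
      (Matrix.isHermitian_add_transpose_self U), ?_⟩
  ext (i | ⟨⟨i, j, hj⟩, k⟩)
  · simp [hermCoord_inl, hU]
  · have hij : i < j := Finset.mem_Ioi.1 hj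
    simp [hermCoord_inr, Matrix.diagonal_apply_ne _ hij.ne, hU hij.not_gt, U, hij]

theorem bijOn_hermCoord_stateTangent :
    Set.BijOn (hermCoord τ) (stateTangent 𝕜 n : Set (Matrix (Fin n) (Fin n) 𝕜))
      (Submodule.span ℝ {hermCoord τ (1 : Matrix (Fin n) (Fin n) 𝕜)})ᗮ := by
  have orthogonal_iff (A : Matrix (Fin n) (Fin n) 𝕜) (hA : A.IsHermitian) :
      hermCoord τ A ∈ (Submodule.span ℝ {hermCoord τ (1 : Matrix (Fin n) (Fin n) 𝕜)})ᗮ ↔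
        A.trace = 0 := by
    have real : RCLike.im A.trace = 0 := RCLike.conj_eq_iff_im.1 <| by
      rw [← RCLike.star_def, ← Matrix.trace_conjTranspose, hA.eq]
    rw [Submodule.mem_orthogonal_singleton_iff_inner_left,
      inner_hermCoord hA Matrix.isHermitian_one, traceMetric, Matrix.mul_one,
      RCLike.ext_iff (z := A.trace)]
    simp [real]
  refine ⟨fun A hA => (orthogonal_iff A hA.1).2 hA.2, injOn_hermCoord.mono fun A hA => hA.1,
    fun w hw => ?_⟩
  obtain ⟨A, hA, rfl⟩ := exists_isHermitian_hermCoord_eq (τ := τ) w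
  exact ⟨A, ⟨hA, (orthogonal_iff A hA).1 hw⟩, rfl⟩

end HermitianCoordinates

section StateSpaceCurvature

open scoped Matrix.Norms.Operator

theorem dslope_ne_zero {f : ℝ → ℝ} {x y : ℝ} (hx : deriv f x ≠ 0) (hxy : f x = f y → x = y) :
    dslope f x y ≠ 0 := by
  rcases eq_or_ne y x with rfl | h
  · rwa [dslope_same]
  · rw [dslope_of_ne f h, slope_def_field]
    exact div_ne_zero (sub_ne_zero.2 fun hf => h (hxy hf.symm).symm) (sub_ne_zero.2 h)

theorem dslope_inv_deriv {f : ℝ → ℝ} {x y : ℝ} (hf : DifferentiableAt ℝ (deriv f) x)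
    (hx : deriv f x ≠ 0) (hy : deriv f y ≠ 0) (hxy : f x = f y → x = y) :
    dslope (deriv f)⁻¹ x y = rho f x y * dslope f x y := by
  rcases eq_or_ne y x with rfl | h
  · rw [dslope_same, dslope_same, deriv_inv_deriv hf hx]
  · have hfxy : f x - f y ≠ 0 := sub_ne_zero.2 fun hf => h (hxy hf).symm
    have hyx : y - x ≠ 0 := sub_ne_zero.2 h
    rw [dslope_of_ne _ h, dslope_of_ne _ h, slope_def_field, slope_def_field, rho,
      if_neg h.symm, Pi.inv_apply, Pi.inv_apply]
    field_simp
    ring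

variable {𝕜 : Type} [RCLike 𝕜] {n : ℕ} {f : ℝ → ℝ}

section TraceMetric

variable {D X Y : Matrix (Fin n) (Fin n) 𝕜} (hD : D.IsHermitian)

theorem traceMetric_inEigenbasis :
    traceMetric (inEigenbasis hD X) (inEigenbasis hD Y) = traceMetric X Y := by
  rw [traceMetric, ← map_mul, trace_inEigenbasis, traceMetric]

/-- In the eigenbasis, the diagonal entries of the derivative are `f'(λᵢ) Xᵢᵢ`. -/
theorem traceMetric_dirDeriv_cfc_inv_deriv (hf : ∀ i, AnalyticAt ℝ f (hD.eigenvalues i))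
    (hf' : ∀ i, deriv f (hD.eigenvalues i) ≠ 0) (hX : X.IsHermitian) :
    traceMetric (dirDeriv (fun A => cfc f A) D X) (cfc (deriv f)⁻¹ D) = RCLike.re X.trace := by
  rw [← traceMetric_inEigenbasis hD, traceMetric, inEigenbasis_cfc, ← trace_inEigenbasis hD X]
  refine congrArg _ (Finset.sum_congr rfl fun i _ => ?_)
  have : ((deriv f (hD.eigenvalues i) : ℝ) : 𝕜) ≠ 0 := RCLike.ofReal_ne_zero.2 (hf' i)
  rw [Matrix.diag_apply, Matrix.mul_diagonal, inEigenbasis_dirDeriv_cfc hD hf hX, dslope_same,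
    RCLike.real_smul_eq_coe_mul, Matrix.diag_apply, Pi.inv_apply, RCLike.ofReal_inv]
  field_simp

end TraceMetric

section EigenCoord

variable {κ : Type} [Fintype κ] (τ : 𝕜 ≃ₗᵢ[ℝ] EuclideanSpace ℝ κ)
  {D A X Y : Matrix (Fin n) (Fin n) 𝕜} (hD : D.IsHermitian)

/-- The real coordinates of a Hermitian matrix in the eigenbasis of `D`. -/
def eigenCoord : Matrix (Fin n) (Fin n) 𝕜 →ₗ[ℝ] EuclideanSpace ℝ (Fin n ⊕ OffDiag n κ) :=
  hermCoord τ ∘ₗ (inEigenbasis hD).toAlgEquiv.toLinearMap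

theorem eigenCoord_apply : eigenCoord τ hD A = hermCoord τ (inEigenbasis hD A) := rfl

theorem inner_eigenCoord (hX : X.IsHermitian) (hY : Y.IsHermitian) :
    inner ℝ (eigenCoord τ hD X) (eigenCoord τ hD Y) = traceMetric X Y := by
  rw [eigenCoord_apply, eigenCoord_apply, inner_hermCoord ((isHermitian_inEigenbasis_iff hD).2 hX)
    ((isHermitian_inEigenbasis_iff hD).2 hY), traceMetric_inEigenbasis]

theorem bijOn_eigenCoord_stateTangent :
    Set.BijOn (eigenCoord τ hD) (stateTangent 𝕜 n : Set (Matrix (Fin n) (Fin n) 𝕜))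
      (Submodule.span ℝ {hermCoord τ (1 : Matrix (Fin n) (Fin n) 𝕜)})ᗮ :=
  bijOn_hermCoord_stateTangent.comp <| Equiv.bijOn (inEigenbasis hD).toEquiv fun X =>
    and_congr (isHermitian_inEigenbasis_iff hD) (by
      rw [← trace_inEigenbasis hD X]
      rfl)

theorem dirDeriv_eigenCoord_cfc (hA : A.IsHermitian)
    (hf : ∀ i, AnalyticAt ℝ f (hA.eigenvalues i)) (hX : X.IsHermitian) :
    dirDeriv (fun B => eigenCoord τ hD (cfc f B)) A X
      = eigenCoord τ hD (dirDeriv (fun B => cfc f B) A X) :=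
  ((eigenCoord τ hD).toContinuousLinearMap.hasFDerivAt.comp_hasDerivAt (0 : ℝ)
    (hasDerivAt_cfc_line hA hf hX)).deriv

theorem dirDeriv_eigenCoord_cfc_apply (hf : ∀ i, AnalyticAt ℝ f (hD.eigenvalues i))
    (hX : X.IsHermitian) (a : Fin n ⊕ OffDiag n κ) :
    dirDeriv (fun A => eigenCoord τ hD (cfc f A)) D X a
      = dslope f (hD.eigenvalues (coordPosition a).1) (hD.eigenvalues (coordPosition a).2)
        * eigenCoord τ hD X a := by
  rw [dirDeriv_eigenCoord_cfc τ hD hD hf hX]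
  exact hermCoord_eq_mul_of_apply_eq_smul
    (s := fun i j => dslope f (hD.eigenvalues i) (hD.eigenvalues j))
    (inEigenbasis_dirDeriv_cfc hD hf hX) a

theorem eigenCoord_cfc_inl (i : Fin n) :
    eigenCoord τ hD (cfc f D) (.inl i) = f (hD.eigenvalues i) := by
  rw [eigenCoord_apply, inEigenbasis_cfc, hermCoord_inl, Matrix.diagonal_apply_eq, RCLike.ofReal_re]

theorem eigenCoord_cfc_inr (a : OffDiag n κ) : eigenCoord τ hD (cfc f D) (.inr a) = 0 := by
  rw [eigenCoord_apply, inEigenbasis_cfc, hermCoord_inr,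
    Matrix.diagonal_apply_ne _ (Finset.mem_Ioi.1 a.1.2.2).ne]
  simp

theorem norm_eigenCoord_cfc_inv_deriv :
    ‖eigenCoord τ hD (cfc (deriv f)⁻¹ D)‖ = cNorm f hD.eigenvalues := by
  simp [cNorm, EuclideanSpace.norm_eq, eigenCoord_cfc_inl, eigenCoord_cfc_inr]

end EigenCoord

section Curvature

variable {κ : Type} [Fintype κ] (τ : 𝕜 ≃ₗᵢ[ℝ] EuclideanSpace ℝ κ)
  {D A X Y : Matrix (Fin n) (Fin n) 𝕜} (hD : D.IsHermitian) {d : ℕ}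
  (b : Module.Basis (Fin d) ℝ (stateTangent 𝕜 n))

include hD in
theorem isHermitian_affineChart (x : Fin d → ℝ) : (affineChart b D x).IsHermitian :=
  sub_add_cancel (affineChart b D x) D ▸ (affineChart_sub_mem (b := b) (p := D) x).1.add hD

theorem contDiffAt_eigenCoord_cfc_affineChart {m : ℕ∞}
    (hf : ∀ i, AnalyticAt ℝ f (hD.eigenvalues i)) :
    ContDiffAt ℝ m (fun x => eigenCoord τ hD (cfc f (affineChart b D x))) 0 :=
  (eigenCoord τ hD).toContinuousLinearMap.contDiff.contDiffAt.comp 0 <|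
    contDiffAt_matrix_cfc (contDiff_linearMap_affineChart LinearMap.id).contDiffAt
      (isHermitian_affineChart hD b) (by simpa using hf)

theorem isOpen_setOf_analyticAt_deriv_ne_zero :
    IsOpen {x | AnalyticAt ℝ f x ∧ deriv f x ≠ 0} :=
  isOpen_iff_mem_nhds.2 fun _ hx =>
    hx.1.eventually_analyticAt.and (hx.1.deriv.continuousAt.eventually_ne hx.2)

theorem eventually_affineChart_eigenvalues (hf : ∀ i, AnalyticAt ℝ f (hD.eigenvalues i))
    (hf' : ∀ i, deriv f (hD.eigenvalues i) ≠ 0) :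
    ∀ᶠ x in 𝓝 0, ∀ i, AnalyticAt ℝ f ((isHermitian_affineChart hD b x).eigenvalues i) ∧
      deriv f ((isHermitian_affineChart hD b x).eigenvalues i) ≠ 0 := by
  have chart_tendsto : Tendsto (fun x => affineChart b D x) (𝓝 0) (𝓝 D) := by
    have h := (contDiff_linearMap_affineChart (b := b) (p := D) (m := 0)
      LinearMap.id).continuous.tendsto 0
    rw [LinearMap.id_apply, affineChart_zero] at h
    exact h
  filter_upwards [chart_tendsto.eventually (eventually_forall_eigenvalues_mem hD
    isOpen_setOf_analyticAt_deriv_ne_zero fun i => ⟨hf i, hf' i⟩)] with x hx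
  exact hx _

theorem gf_eq_inner_dirDeriv_eigenCoord (hA : A.IsHermitian)
    (hf : ∀ i, AnalyticAt ℝ f (hA.eigenvalues i)) (hX : X.IsHermitian) (hY : Y.IsHermitian) :
    gf f A X Y = inner ℝ (dirDeriv (fun B => eigenCoord τ hD (cfc f B)) A X)
      (dirDeriv (fun B => eigenCoord τ hD (cfc f B)) A Y) := by
  rw [dirDeriv_eigenCoord_cfc τ hD hA hf hX, dirDeriv_eigenCoord_cfc τ hD hA hf hY,
    inner_eigenCoord τ hD (isHermitian_dirDeriv_cfc hA hf hX) (isHermitian_dirDeriv_cfc hA hf hY)]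
  rfl

theorem inner_dirDeriv_eigenCoord_inv_deriv (hA : A.IsHermitian)
    (hf : ∀ i, AnalyticAt ℝ f (hA.eigenvalues i)) (hf' : ∀ i, deriv f (hA.eigenvalues i) ≠ 0)
    (hX : X ∈ stateTangent 𝕜 n) :
    inner ℝ (dirDeriv (fun B => eigenCoord τ hD (cfc f B)) A X)
      (eigenCoord τ hD (cfc (deriv f)⁻¹ A)) = 0 := by
  have normal_isHermitian : (cfc (deriv f)⁻¹ A).IsHermitian := cfc_predicate _ A
  rw [dirDeriv_eigenCoord_cfc τ hD hA hf hX.1,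
    inner_eigenCoord τ hD (isHermitian_dirDeriv_cfc hA hf hX.1) normal_isHermitian,
    traceMetric_dirDeriv_cfc_inv_deriv hA hf hf' hX.1, hX.2, map_zero]

theorem eigenCoord_cfc_inv_deriv_apply (a : Fin n ⊕ OffDiag n κ) :
    eigenCoord τ hD (cfc (deriv f)⁻¹ D) a = hermCoord τ (1 : Matrix (Fin n) (Fin n) 𝕜) a
      / dslope f (hD.eigenvalues (coordPosition a).1) (hD.eigenvalues (coordPosition a).2) := by
  rcases a with i | a
  · simp [eigenCoord_cfc_inl, hermCoord_inl, coordPosition]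
  · simp [eigenCoord_cfc_inr, hermCoord_inr, Matrix.one_apply_ne (Finset.mem_Ioi.1 a.1.2.2).ne]

theorem scalarCurvature_gf_eq_sum_coordPosition [NeZero n] [DecidableEq κ]
    (hf : ∀ i, AnalyticAt ℝ f (hD.eigenvalues i)) (hf' : ∀ i, deriv f (hD.eigenvalues i) ≠ 0)
    (hinj : Set.InjOn f (Set.range hD.eigenvalues)) {ρ ν : Fin n ⊕ OffDiag n κ → ℝ}
    (hρ : ∀ a, ρ a
      = rho f (hD.eigenvalues (coordPosition a).1) (hD.eigenvalues (coordPosition a).2))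
    (hν : ∀ a, ν a = eigenCoord τ hD (cfc (deriv f)⁻¹ D) a ^ 2 / cNorm f hD.eigenvalues ^ 2) :
    scalarCurvature b (gf f) D
      = (∑ a, ∑ k ∈ Finset.univ.erase a, ρ a * ρ k * (1 - ν a - ν k))
        / cNorm f hD.eigenvalues ^ 2 := by
  have hinv : ∀ i, AnalyticAt ℝ (deriv f)⁻¹ (hD.eigenvalues i) := fun i => (hf i).deriv.inv (hf' i)
  have heq : ∀ i j, f (hD.eigenvalues i) = f (hD.eigenvalues j) →
      hD.eigenvalues i = hD.eigenvalues j := fun i j => hinj ⟨i, rfl⟩ ⟨j, rfl⟩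
  have chart := eventually_affineChart_eigenvalues hD b hf hf'
  rw [scalarCurvature_pullback_of_adapted (b := b) (g := gf f) (p := D) (ρ := ρ)
    (u := fun A => eigenCoord τ hD (cfc f A))
    (N := fun A => eigenCoord τ hD (cfc (deriv f)⁻¹ A)) (co := eigenCoord τ hD)
    (s := fun a =>
      dslope f (hD.eigenvalues (coordPosition a).1) (hD.eigenvalues (coordPosition a).2))
    (contDiffAt_eigenCoord_cfc_affineChart τ hD b hf) ?metric
    ((contDiffAt_eigenCoord_cfc_affineChart (m := 1) τ hD b hinv).differentiableAt (by simp))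
    ?orthogonal (fun a => dslope_ne_zero (hf' _) (heq _ _)) ?nonzero
    (bijOn_eigenCoord_stateTangent τ hD)
    (fun X hX => dirDeriv_eigenCoord_cfc_apply τ hD hf hX.1) ?shape
    (eigenCoord_cfc_inv_deriv_apply τ hD)]
  case metric =>
    filter_upwards [chart] with x hx X hX Y hY
    exact gf_eq_inner_dirDeriv_eigenCoord τ hD _ (fun i => (hx i).1) hX.1 hY.1
  case orthogonal =>
    filter_upwards [chart] with x hx X hX
    exact inner_dirDeriv_eigenCoord_inv_deriv τ hD _ (fun i => (hx i).1) (fun i => (hx i).2) hX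
  case nonzero =>
    exact fun h => one_ne_zero (α := ℝ) (by
      simpa [hermCoord_inl] using congrArg (· (.inl (0 : Fin n))) h)
  case shape =>
    intro X hX a
    rw [dirDeriv_eigenCoord_cfc_apply τ hD hinv hX.1, dirDeriv_eigenCoord_cfc_apply τ hD hf hX.1,
      dslope_inv_deriv (hf _).deriv.differentiableAt (hf' _) (hf' _) (heq _ _), hρ, mul_assoc]
  simp only [norm_eigenCoord_cfc_inv_deriv, hν]

include τ in
theorem scalarCurvature_gf_stateTangent [NeZero n]
    (hf : ∀ i, AnalyticAt ℝ f (hD.eigenvalues i)) (hf' : ∀ i, deriv f (hD.eigenvalues i) ≠ 0)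
    (hinj : Set.InjOn f (Set.range hD.eigenvalues)) {l : Fin n → ℝ} (hl : l = hD.eigenvalues) :
    scalarCurvature b (gf f) D
      = 4 / cNorm f l ^ 4 * (diagDoubleSum f l - diagSum f l * (Fintype.card κ * rhoSum f l))
        + (Fintype.card κ * rhoSum f l) ^ 2 / cNorm f l ^ 2
        - Fintype.card κ * rhoSqSum f l / cNorm f l ^ 2 := by
  classical
  subst hl
  have hc : cNorm f hD.eigenvalues ≠ 0 := cNorm_ne_zero hf'
  rw [scalarCurvature_gf_eq_sum_coordPosition τ hD b hf hf' hinj (fun _ => rfl) (fun _ => rfl),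
    sum_sum_erase_sumType _ _ fun a => by simp [eigenCoord_cfc_inr]]
  simp only [eigenCoord_cfc_inl, coordPosition, Sum.elim_inl, Sum.elim_inr, Pi.inv_apply,
    inv_eq_one_div (deriv f _)]
  rw [sum_erase_rho_self_mul_eq_diagDoubleSum hc, sum_rho_self_mul_eq_diagSum hc,
    sum_offDiag fun i j => rho f (hD.eigenvalues i) (hD.eigenvalues j),
    sum_offDiag fun i j => rho f (hD.eigenvalues i) (hD.eigenvalues j) ^ 2, ← rhoSum, ← rhoSqSum]
  field_simp
  ring

end Curvature

end StateSpaceCurvature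

section Admissible

variable {f : ℝ → ℝ}

theorem Admissible.analyticAt (hf : Admissible f) {x : ℝ} (hx : x ∈ Set.Ioo 0 1) :
    AnalyticAt ℝ f x := by
  obtain ⟨⟨U, F, hU, hmem, hF, hFf⟩, -⟩ := hf
  refine (hF.analyticAt (hU.mem_nhds (hmem x hx))).re_ofReal.congr ?_
  filter_upwards [isOpen_Ioo.mem_nhds hx] with t ht
  rw [hFf t ht, Complex.ofReal_re]

theorem injOn_of_deriv_ne_zero {s : Set ℝ} (hs : s.OrdConnected)
    (hf' : ∀ x ∈ s, deriv f x ≠ 0) : Set.InjOn f s := by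
  intro x hx y hy hxy
  by_contra hne
  wlog hlt : x < y generalizing x y
  · exact this hy hx hxy.symm (Ne.symm hne) ((lt_or_gt_of_ne hne).resolve_left hlt)
  have continuousOn : ContinuousOn f (Set.Icc x y) := fun z hz =>
    (differentiableAt_of_deriv_ne_zero (hf' z (hs.out hx hy hz))).continuousAt.continuousWithinAt
  obtain ⟨z, hz, hfz⟩ := exists_deriv_eq_zero hlt continuousOn hxy
  exact hf' z (hs.out hx hy (Set.Ioo_subset_Icc_self hz)) hfz

end Admissible

section SinglePoint

theorem scalarCurvature_eq_zero_of_eq_bot {E : Type*} [AddCommGroup E] [Module ℝ E]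
    {T : Submodule ℝ E} (hT : T = ⊥) {d : ℕ} (b : Module.Basis (Fin d) ℝ T)
    (g : E → E → E → ℝ) (p : E) : scalarCurvature b g p = 0 := by
  have : Subsingleton T := (Submodule.subsingleton_iff_eq_bot).2 hT
  have : IsEmpty (Fin d) := ⟨fun i => b.ne_zero i (Subsingleton.elim _ _)⟩
  simp [scalarCurvature]

variable {𝕜 : Type} [RCLike 𝕜]

theorem stateTangent_one : stateTangent 𝕜 1 = ⊥ := by
  refine (Submodule.eq_bot_iff _).2 fun X hX => ?_
  ext i j
  rw [Subsingleton.elim i 0, Subsingleton.elim j 0]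
  exact (Matrix.trace_fin_one X).symm.trans hX.2

theorem diagTangent_one : diagTangent 𝕜 1 = ⊥ :=
  eq_bot_iff.2 fun _ hX => stateTangent_one.le hX.1

end SinglePoint

section States

open scoped ComplexOrder

variable {n : ℕ}

theorem lt_one_of_sum_eq_one (hn : n ≠ 1) {l : Fin n → ℝ} (hpos : ∀ i, 0 < l i)
    (hsum : ∑ i, l i = 1) (i : Fin n) : l i < 1 := by
  have : NeZero n := ⟨i.pos.ne'⟩
  have : Nontrivial (Fin n) := Fin.nontrivial_iff_two_le.2 (by have := i.pos; omega)
  obtain ⟨j, hj⟩ := exists_ne i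
  exact hsum ▸ Finset.single_lt_sum hj (Finset.mem_univ i) (Finset.mem_univ j) (hpos j)
    fun k _ _ => (hpos k).le

variable {𝕜 : Type} [RCLike 𝕜]

theorem neZero_of_mem_stateSpace {D : Matrix (Fin n) (Fin n) 𝕜} (hD : D ∈ stateSpace 𝕜 n) :
    NeZero n :=
  ⟨by rintro rfl; simpa [Matrix.trace] using hD.2⟩

theorem eigenvalues_mem_Ioo_of_mem_stateSpace (hn : n ≠ 1) {D : Matrix (Fin n) (Fin n) 𝕜}
    (hD : D ∈ stateSpace 𝕜 n) (i : Fin n) :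
    (stateSpace.isHermitian hD).eigenvalues i ∈ Set.Ioo 0 1 := by
  have hpos := hD.1.eigenvalues_pos
  refine ⟨hpos i, lt_one_of_sum_eq_one hn hpos ?_ i⟩
  exact_mod_cast (hD.2.symm.trans (stateSpace.isHermitian hD).trace_eq_sum_eigenvalues).symm

theorem scalarCurvature_stateSpace {κ : Type} [Fintype κ] (τ : 𝕜 ≃ₗᵢ[ℝ] EuclideanSpace ℝ κ)
    {f : ℝ → ℝ} (hf : Admissible f) {D : Matrix (Fin n) (Fin n) 𝕜} (hD : D ∈ stateSpace 𝕜 n)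
    {d : ℕ} (b : Module.Basis (Fin d) ℝ (stateTangent 𝕜 n)) {l : Fin n → ℝ}
    (hl : l = (stateSpace.isHermitian hD).eigenvalues) :
    scalarCurvature b (gf f) D
      = 4 / cNorm f l ^ 4 * (diagDoubleSum f l - diagSum f l * (Fintype.card κ * rhoSum f l))
        + (Fintype.card κ * rhoSum f l) ^ 2 / cNorm f l ^ 2
        - Fintype.card κ * rhoSqSum f l / cNorm f l ^ 2 := by
  have := neZero_of_mem_stateSpace hD
  rcases eq_or_ne n 1 with rfl | hn
  · rw [scalarCurvature_eq_zero_of_eq_bot stateTangent_one]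
    simp [diagDoubleSum, rhoSum, rhoSqSum]
  · have mem_Ioo := eigenvalues_mem_Ioo_of_mem_stateSpace hn hD
    exact scalarCurvature_gf_stateTangent τ (stateSpace.isHermitian hD) b
      (fun i => hf.analyticAt (mem_Ioo i)) (fun i => hf.2 _ (mem_Ioo i))
      ((injOn_of_deriv_ne_zero Set.ordConnected_Ioo hf.2).mono (Set.range_subset_iff.2 mem_Ioo)) hl

end States

section DiagonalStates

variable {n : ℕ}

theorem cfc_diagonal (f : ℝ → ℝ) (v : Fin n → ℝ) :
    cfc f (Matrix.diagonal v) = Matrix.diagonal fun k => f (v k) := by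
  ext i j
  have h : Matrix.diagonal v - algebraMap ℝ _ (v i) = Matrix.diagonal fun k => v k - v i := by
    rw [Algebra.algebraMap_eq_smul_one, Matrix.smul_one_eq_diagonal, Matrix.diagonal_sub]
  rw [cfc_eq_add_mul_cfc_dslope (Matrix.isHermitian_diagonal v) f (v i), h, Matrix.add_apply,
    Matrix.diagonal_mul, sub_self, zero_mul, add_zero, Algebra.algebraMap_eq_smul_one,
    Matrix.smul_one_eq_diagonal, Matrix.diagonal_apply, Matrix.diagonal_apply]

/-- The diagonal entries of a real matrix, as coordinates with values in the Euclidean space. -/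
def diagCoords (n : ℕ) : Matrix (Fin n) (Fin n) ℝ →ₗ[ℝ] EuclideanSpace ℝ (Fin n) :=
  euclideanCoords n ∘ₗ Matrix.diagLinearMap (Fin n) ℝ ℝ

theorem ofLp_diagCoords (D : Matrix (Fin n) (Fin n) ℝ) : (diagCoords n D).ofLp = D.diag := rfl

theorem bijOn_diagCoords_diagTangent :
    Set.BijOn (diagCoords n) (diagTangent ℝ n) {w | ∑ k, w k = 0} := by
  refine ⟨fun X hX => hX.1.2, fun X hX Y hY h => ?_, fun w hw => ?_⟩
  · rw [← hX.2.diagonal_diag, ← hY.2.diagonal_diag]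
    exact congrArg Matrix.diagonal (congrArg WithLp.ofLp h)
  · refine ⟨Matrix.diagonal w, ⟨⟨Matrix.isHermitian_diagonal _, ?_⟩, Matrix.isDiag_diagonal _⟩, ?_⟩
    · rw [Matrix.trace_diagonal, hw]
    · ext k
      exact Matrix.diagonal_apply_eq _ k

variable {f : ℝ → ℝ} {D X Y : Matrix (Fin n) (Fin n) ℝ}

theorem dirDeriv_cfc_of_isDiag (hD : D.IsDiag) (hX : X.IsDiag)
    (hf : ∀ k, DifferentiableAt ℝ f (D k k)) :
    dirDeriv (fun A => cfc f A) D X = Matrix.diagonal fun k => deriv f (D k k) * X k k := by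
  have cfc_line (r : ℝ) : cfc f (D + r • X) = Matrix.diagonal fun k => f (D k k + r * X k k) := by
    rw [← cfc_diagonal f fun k => D k k + r * X k k]
    exact congrArg (cfc f) (hD.add (hX.smul r)).diagonal_diag.symm
  have entry (k : Fin n) :
      HasDerivAt (fun r => f (D k k + r * X k k)) (deriv f (D k k) * X k k) 0 :=
    HasDerivAt.comp (h₂ := f) 0 (by simpa using (hf k).hasDerivAt)
      (hasDerivAt_linearMap_line (Matrix.entryLinearMap ℝ ℝ k k) D X)
  have entrywise : HasDerivAt (fun (r : ℝ) (i j : Fin n) => cfc f (D + r • X) i j)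
      (fun i j => Matrix.diagonal (fun k => deriv f (D k k) * X k k) i j) 0 := by
    refine hasDerivAt_pi.2 fun i => hasDerivAt_pi.2 fun j => ?_
    simp only [cfc_line, Matrix.diagonal_apply]
    split_ifs
    exacts [entry i, hasDerivAt_const _ _]
  exact entrywise.deriv

theorem gf_eq_inner_dirDeriv_diagCoords (hD : D.IsDiag) (hX : X.IsDiag) (hY : Y.IsDiag)
    (hf : ∀ k, DifferentiableAt ℝ f (D k k)) :
    gf f D X Y = inner ℝ (dirDeriv (mapCoords (diagCoords n) f) D X)
      (dirDeriv (mapCoords (diagCoords n) f) D Y) := by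
  rw [dirDeriv_mapCoords hf, dirDeriv_mapCoords hf, gf, pullbackMetric,
    dirDeriv_cfc_of_isDiag hD hX hf, dirDeriv_cfc_of_isDiag hD hY hf, traceMetric,
    Matrix.diagonal_mul_diagonal, Matrix.trace_diagonal, EuclideanSpace.inner_toLp_toLp,
    dotProduct_comm]
  rfl

theorem scalarCurvature_diagTangent (hf : Admissible f) (hD : D ∈ stateSpace ℝ n)
    (hdiag : D.IsDiag) {d : ℕ} (b : Module.Basis (Fin d) ℝ (diagTangent ℝ n)) :
    scalarCurvature b (gf f) D = 4 / cNorm f D.diag ^ 4 * diagDoubleSum f D.diag := by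
  have := neZero_of_mem_stateSpace hD
  rcases eq_or_ne n 1 with rfl | hn
  · rw [scalarCurvature_eq_zero_of_eq_bot diagTangent_one]
    simp [diagDoubleSum]
  · have mem_Ioo (k : Fin n) : D k k ∈ Set.Ioo 0 1 :=
      ⟨hD.1.diag_pos, lt_one_of_sum_eq_one hn (fun _ => hD.1.diag_pos) hD.2 k⟩
    have isDiag_of_sub_mem {q : Matrix (Fin n) (Fin n) ℝ} (hq : q - D ∈ diagTangent ℝ n) :
        q.IsDiag := sub_add_cancel q D ▸ hq.2.add hdiag
    rw [scalarCurvature_pullback_mapCoords (g := gf f) (p := D) (b := b)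
      bijOn_diagCoords_diagTangent (fun k => (hf.analyticAt (mem_Ioo k)).contDiffAt)
      (fun k => hf.2 _ (mem_Ioo k)) fun q hq hfq X hX Y hY =>
        gf_eq_inner_dirDeriv_diagCoords (isDiag_of_sub_mem hq) hX.2 hY.2 hfq, ofLp_diagCoords]

end DiagonalStates

end

theorem mainTheorem4 :
    -- the state space of real and of complex matrices, and the space of diagonal states
    (∀ (n : ℕ) (f : ℝ → ℝ), Admissible f →
      (∀ (D : Matrix (Fin n) (Fin n) ℝ) (hD : D ∈ stateSpace ℝ n)
          (d : ℕ) (b : Module.Basis (Fin d) ℝ (stateTangent ℝ n))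
          (l : Fin n → ℝ), l = (stateSpace.isHermitian hD).eigenvalues →
        scalarCurvature b (gf f) D =
          4 / cNorm f l ^ 4 * (diagDoubleSum f l - diagSum f l * rhoSum f l)
            + 1 / cNorm f l ^ 2 * rhoSum f l ^ 2 - 1 / cNorm f l ^ 2 * rhoSqSum f l) ∧
      (∀ (D : Matrix (Fin n) (Fin n) ℂ) (hD : D ∈ stateSpace ℂ n)
          (d : ℕ) (b : Module.Basis (Fin d) ℝ (stateTangent ℂ n))
          (l : Fin n → ℝ), l = (stateSpace.isHermitian hD).eigenvalues →
        scalarCurvature b (gf f) D =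
          4 / cNorm f l ^ 4 * (diagDoubleSum f l - 2 * (diagSum f l * rhoSum f l))
            + 4 / cNorm f l ^ 2 * rhoSum f l ^ 2 - 2 / cNorm f l ^ 2 * rhoSqSum f l) ∧
      (∀ (D : Matrix (Fin n) (Fin n) ℝ), D ∈ stateSpace ℝ n → D.IsDiag →
          ∀ (d : ℕ) (b : Module.Basis (Fin d) ℝ (diagTangent ℝ n)),
        scalarCurvature b (gf f) D = 4 / cNorm f D.diag ^ 4 * diagDoubleSum f D.diag)) ∧
    -- the classical `α`-geometry, for every real `α` (also `α = 1`)
    (∀ (n : ℕ) (α : ℝ) (θ : Fin n → ℝ), θ ∈ probSpace n →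
        ∀ (d : ℕ) (b : Module.Basis (Fin d) ℝ (probTangent n))
          (c : ℝ), c = √(∑ k, θ k ^ (α + 1)) →
      scalarCurvature b (gAlpha α) θ =
        (1 + α) ^ 2 / (4 * c ^ 2) * ∑ t, ∑ s ∈ Finset.univ.erase t,
          θ t ^ α * θ s ^ α * (1 - (θ t ^ (α + 1) + θ s ^ (α + 1)) / c ^ 2)) := by
  refine ⟨fun n f hf => ⟨fun D hD d b l hl => ?_, fun D hD d b l hl => ?_,
    fun D hD hdiag d b => scalarCurvature_diagTangent hf hD hdiag b⟩,
    fun n α θ hθ d b c hc => scalarCurvature_gAlpha α hθ b hc⟩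
  · rw [scalarCurvature_stateSpace (OrthonormalBasis.singleton Unit ℝ).repr hf hD b hl]
    simp only [Fintype.card_unit, Nat.cast_one]
    ring
  · rw [scalarCurvature_stateSpace Complex.orthonormalBasisOneI.repr hf hD b hl]
    simp only [Fintype.card_fin, Nat.cast_ofNat]
    ring
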